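/- Let $\mathbb F$ be a field of characteristic $0$, and let $R$ be a finitely generated commutative associative unital $\mathbb F$-algebra. A Lie algebroid (LAd) over $R$ is an $R$-module $F$ with an $\mathbb F$-Lie bracket and an $R$-linear Lie algebra homomorphism $\theta:F\to\mathrm{Der}(R)$ (the anchor) such that $[u,rv]=r[u,v]+\theta(u)(r)v$ for all $u,v\in F$, $r\in R$. Let $(F,[\cdot,\cdot],\theta)$ be a LAd over $R$. Notation. A differential algebra is a commutative associative unital $\mathbb F$-algebra $A$ with a derivation $\partial$; $A[\partial]$ is the algebra of differential operators over $A$. A conformal derivation of $A$ is a linear map $\phi_\lambda:A\to A[\lambda]$ with $\phi_\lambda(\partial a)=(\partial+\lambda)\phi_\lambda(a)$ and $\phi_\lambda(ab)=\phi_\lambda(a)b+a\phi_\lambda(b)$. The space $\mathrm{CDer}(A)$ of these is a left $A[\partial]$-module by $(\partial\phi)_\lambda=-\lambda\phi_\lambda$ and $(a\phi)_\lambda(b)=\sum_n c_n(\lambda+\partial)^n a$ if $\phi_\lambda(b)=\sum_n\lambda^n c_n$. A Lie conformal algebroid (LCAd) over $A$ is a left $A[\partial]$-module $E$ with a bilinear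 $\lambda$-bracket $[\cdot_\lambda\cdot]:E\times E\to E[\lambda]$ and a left $A[\partial]$-module homomorphism $\theta:E\to\mathrm{CDer}(A)$ (the anchor) such that $$[\partial u_\lambda v]=-\lambda[u_\lambda v],\qquad [u_\lambda\partial v]=(\partial+\lambda)[u_\lambda v],\qquad [v_\lambda u]=-\sum_n(-\lambda-\partial)^n e_n\ \text{ if } [u_\lambda v]=\sum_n\lambda^n e_n,$$ $$[u_\lambda[v_\mu w]]-[v_\mu[u_\lambda w]]=[[u_\lambda v]_{\lambda+\mu}w],\qquad [u_\lambda av]=\theta(u)_\lambda(a)\,v+a[u_\lambda v],$$ $$\theta([u_\lambda v])_\mu(a)=\theta(u)_\lambda(\theta(v)_{\mu-\lambda}(a))-\theta(v)_{\mu-\lambda}(\theta(u)_\lambda(a)).$$ Its quotient LAd is the LAd $\bar E=E/A\partial E$ over $\bar A=A/A\partial A$ (the quotient by the ideal generated by $\partial A$) with $[\bar u,\bar v]=\overline{[u_\lambda v]|_{\lambda=0}}$ and $\bar\theta(\bar u)(\bar a)=\overline{\theta(u)_\lambda(a)|_{\lambda=0}}$. Let $\iota:R\to J_\infty R$ be the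 jet algebra of $R$, the universal algebra homomorphism from $R$ to a differential algebra. Let $\widehat F=J_\infty R[\partial]\otimes_R F$, where $R$ acts on $J_\infty R[\partial]$ by right multiplication through $\iota$. Proposition. (a) For every $D\in\mathrm{Der}(R)$ there is a unique $\widehat D\in\mathrm{CDer}(J_\infty R)$, the conformal lift of $D$, with $\widehat D_\lambda(\iota(r))=\iota(D(r))$ for all $r\in R$. (b) There is a unique LCAd structure over $J_\infty R$ on the left $J_\infty R[\partial]$-module $\widehat F$ (the current LCAd of $F$) whose $\lambda$-bracket satisfies $[1\otimes u\,_\lambda\,1\otimes v]=1\otimes[u,v]$ for all $u,v\in F$ and whose anchor maps $1\otimes u$ to the conformal lift $\widehat{\theta(u)}$ of $\theta(u)$ for all $u\in F$. (c) The quotient LAd of the current LCAd is canonically isomorphic to $F$: the map $r\mapsto\overline{\iota(r)}$ is an algebra isomorphism $R\to\overline{J_\infty R}$, and over it $u\mapsto\overline{1\otimes u}$ is an isomorphism of Lie algebroids $F\to\overline{\widehat F}$ (bijective, compatible with module structures, brackets and anchors). -/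

import Mathlib

set_option linter.unusedSectionVars false

open scoped TensorProduct

noncomputable section

/-- `E[λ]`: a polynomial `∑ λⁿ eₙ` in a formal variable with coefficients in `E`. -/
abbrev LPoly (E : Type*) [AddCommGroup E] : Type _ := ℕ →₀ E

namespace LPoly

section Basic

variable (𝔽 : Type*) [Field 𝔽] {E V : Type*} [AddCommGroup E] [Module 𝔽 E]
  [AddCommGroup V] [Module 𝔽 V]

/-- The constant polynomial `e`. -/
def const (e : E) : LPoly E := Finsupp.single 0 e

/-- Multiplication by the formal variable, `∑ λⁿ eₙ ↦ ∑ λⁿ⁺¹ eₙ`. -/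
def mulVar : Module.End 𝔽 (LPoly E) := Finsupp.lmapDomain E 𝔽 Nat.succ

/-- A linear map applied to the coefficients, `∑ λⁿ eₙ ↦ ∑ λⁿ f(eₙ)`. -/
def map (f : E →ₗ[𝔽] V) : LPoly E →ₗ[𝔽] LPoly V := Finsupp.mapRange.linearMap f

variable {𝔽} in
/-- Substitution of an operator `T` on `V` for the formal variable, the coefficients being sent to
`V` by `j`: `∑ λⁿ eₙ ↦ ∑ Tⁿ (j eₙ)`. -/
def subst (T : Module.End 𝔽 V) (j : E → V) (p : LPoly E) : V := p.sum fun n e => (T ^ n) (j e)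

/-- The constant `e`, as an element of `E[λ, μ]`, which is modelled as `E[λ][μ]`. -/
def const₂ (e : E) : LPoly (LPoly E) := const (const e)

/-- Multiplication by the first variable `λ` on `E[λ, μ] = E[λ][μ]`. -/
def var₁ : Module.End 𝔽 (LPoly (LPoly E)) := map 𝔽 (mulVar 𝔽)

/-- Multiplication by the second variable `μ` on `E[λ, μ] = E[λ][μ]`. -/
def var₂ : Module.End 𝔽 (LPoly (LPoly E)) := mulVar 𝔽

theorem mulVar_single (n : ℕ) (e : E) :
    mulVar 𝔽 (Finsupp.single n e) = Finsupp.single (n + 1) e := by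
  simp [mulVar, Finsupp.lmapDomain_apply, Finsupp.mapDomain_single]

theorem mulVar_apply_zero (p : LPoly E) : mulVar 𝔽 p 0 = 0 := by
  refine Finsupp.mapDomain_of_notMem_range _ _ ?_
  simp

theorem map_apply (f : E →ₗ[𝔽] V) (p : LPoly E) (n : ℕ) : map 𝔽 f p n = f (p n) := rfl

theorem map_single (f : E →ₗ[𝔽] V) (n : ℕ) (e : E) :
    map 𝔽 f (Finsupp.single n e) = Finsupp.single n (f e) := by
  simp [map]

end Basic

section Derivation

variable {𝔽 A : Type*} [Field 𝔽] [CommRing A] [Algebra 𝔽 A] (d : Derivation 𝔽 A A)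

/-- The operator `λ + ∂` on `A[λ]`, for a differential algebra `(A, ∂)`. -/
def varAdd : Module.End 𝔽 (LPoly A) := mulVar 𝔽 + map 𝔽 (d : A →ₗ[𝔽] A)

theorem varAdd_single (n : ℕ) (b : A) :
    varAdd d (Finsupp.single n b) = Finsupp.single (n + 1) b + Finsupp.single n (d b) := by
  simp [varAdd, mulVar_single, map_single]

theorem varAdd_smul (a : A) (p : LPoly A) :
    varAdd d (a • p) = a • varAdd d p + d a • p := by
  induction p using Finsupp.induction_linear with
  | zero => simp
  | add p q hp hq => simp only [smul_add, map_add, hp, hq]; abel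
  | single n b =>
    simp only [Finsupp.smul_single, varAdd_single, smul_add, smul_eq_mul, Derivation.leibniz,
      Finsupp.single_add]
    rw [mul_comm b (d a)]; abel

theorem mulVar_smul (a : A) (p : LPoly A) : mulVar 𝔽 (a • p) = a • mulVar 𝔽 p := by
  induction p using Finsupp.induction_linear with
  | zero => simp
  | add p q hp hq => simp only [smul_add, map_add, hp, hq]
  | single n b => rw [Finsupp.smul_single, mulVar_single, mulVar_single, Finsupp.smul_single]

theorem varAdd_mulVar (p : LPoly A) : varAdd d (mulVar 𝔽 p) = mulVar 𝔽 (varAdd d p) := by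
  induction p using Finsupp.induction_linear with
  | zero => simp
  | add p q hp hq => simp only [map_add, hp, hq]
  | single n b => simp [mulVar_single, varAdd_single]

theorem varAdd_pow_mulVar (n : ℕ) (p : LPoly A) :
    (varAdd d ^ n) (mulVar 𝔽 p) = mulVar 𝔽 ((varAdd d ^ n) p) := by
  induction n with
  | zero => simp
  | succ n ih => rw [pow_succ', Module.End.mul_apply, Module.End.mul_apply, ih, varAdd_mulVar]

/-- `∑ λⁿ cₙ ↦ ∑ cₙ (λ + ∂)ⁿ a`; that is, `p(λ) ↦ (|_{x = ∂} a) p(λ + x)`. -/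
def shiftMul (a : A) : LPoly A →ₗ[A] LPoly A :=
  Finsupp.lsum A fun n => LinearMap.toSpanSingleton A (LPoly A) ((varAdd d ^ n) (const a))

theorem shiftMul_single (a : A) (n : ℕ) (c : A) :
    shiftMul d a (Finsupp.single n c) = c • (varAdd d ^ n) (const a) := by
  simp [shiftMul]

theorem shiftMul_mulVar (a : A) (p : LPoly A) :
    shiftMul d a (mulVar 𝔽 p) = mulVar 𝔽 (shiftMul d a p) + shiftMul d (d a) p := by
  induction p using Finsupp.induction_linear with
  | zero => simp
  | add p q hp hq => simp only [map_add, hp, hq]; abel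
  | single n c =>
    have h : varAdd d (const a) = mulVar 𝔽 (const a) + const (d a) := by
      simp [const, varAdd_single, mulVar_single]
    rw [mulVar_single, shiftMul_single, shiftMul_single, shiftMul_single, pow_succ,
      Module.End.mul_apply, h, map_add, varAdd_pow_mulVar, smul_add, mulVar_smul]

theorem shiftMul_varAdd (a : A) (p : LPoly A) :
    shiftMul d a (varAdd d p) = varAdd d (shiftMul d a p) := by
  induction p using Finsupp.induction_linear with
  | zero => simp
  | add p q hp hq => simp only [map_add, hp, hq]
  | single n c =>
    rw [varAdd_single, map_add, shiftMul_single, shiftMul_single, shiftMul_single, varAdd_smul,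
      pow_succ', Module.End.mul_apply]

theorem shiftMul_add (a b : A) : shiftMul d (a + b) = shiftMul d a + shiftMul d b := by
  refine Finsupp.lhom_ext fun n c => ?_
  simp [shiftMul_single, const]

theorem shiftMul_zero : shiftMul d 0 = 0 := by
  refine Finsupp.lhom_ext fun n c => ?_
  simp [shiftMul_single, const]

theorem shiftMul_mul (a b : A) (p : LPoly A) :
    shiftMul d (a * b) p = shiftMul d a (shiftMul d b p) := by
  induction p using Finsupp.induction_linear with
  | zero => simp
  | add p q hp hq => simp only [map_add, hp, hq]
  | single n c =>
    induction n generalizing a b c with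
    | zero =>
      simp only [shiftMul_single, const, pow_zero, Module.End.one_apply, Finsupp.smul_single,
        smul_eq_mul]
      rw [mul_comm a b, mul_assoc]
    | succ n ih =>
      rw [← mulVar_single (𝔽 := 𝔽), shiftMul_mulVar, shiftMul_mulVar, map_add, shiftMul_mulVar, ih,
        Derivation.leibniz, shiftMul_add, LinearMap.add_apply, smul_eq_mul, smul_eq_mul, ih,
        mul_comm b, ih]
      abel

theorem shiftMul_one (p : LPoly A) : shiftMul d 1 p = p := by
  induction p using Finsupp.induction_linear with
  | zero => simp
  | add p q hp hq => simp only [map_add, hp, hq]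
  | single n c =>
    induction n generalizing c with
    | zero => simp [shiftMul_single, const]
    | succ n ih =>
      rw [← mulVar_single (𝔽 := 𝔽), shiftMul_mulVar, ih]
      simp [shiftMul, const]

end Derivation

end LPoly

/-- The algebra `A[∂]` of differential operators over a differential algebra `(A, ∂)`; the finitely
supported family `(aₙ)` is the operator `∑ aₙ ∂ⁿ`. -/
def DiffOp {𝔽 A : Type*} [Field 𝔽] [CommRing A] [Algebra 𝔽 A] (_ : Derivation 𝔽 A A) : Type _ :=
  LPoly A

namespace DiffOp

open LPoly

variable {𝔽 A : Type*} [Field 𝔽] [CommRing A] [Algebra 𝔽 A] {d : Derivation 𝔽 A A}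

instance : AddCommGroup (DiffOp d) := inferInstanceAs (AddCommGroup (LPoly A))
instance : Module A (DiffOp d) := inferInstanceAs (Module A (LPoly A))
instance : Module 𝔽 (DiffOp d) := inferInstanceAs (Module 𝔽 (LPoly A))
instance : IsScalarTower 𝔽 A (DiffOp d) := inferInstanceAs (IsScalarTower 𝔽 A (LPoly A))

/-- The operator `a ∂ⁿ`. -/
def mono (n : ℕ) (a : A) : DiffOp d := (Finsupp.single n a : LPoly A)

/-- The value of `∑ aₙ ∂ⁿ` in a ring `S`, when `∂` is sent to `T` and `A` is mapped to `S` by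
`f`. -/
def act {S : Type*} [Semiring S] (f : A →+* S) (T : S) : DiffOp d →+ S :=
  Finsupp.liftAddHom fun n => (AddMonoidHom.mulRight (T ^ n)).comp (f : A →+ S)

theorem act_mono {S : Type*} [Semiring S] (f : A →+* S) (T : S) (n : ℕ) (a : A) :
    act f T (mono n a : DiffOp d) = f a * T ^ n := by
  exact (Finsupp.liftAddHom_apply_single _ n a).trans rfl

@[elab_as_elim]
theorem induction {p : DiffOp d → Prop} (P : DiffOp d) (zero : p 0)
    (add : ∀ P Q, p P → p Q → p (P + Q)) (mono : ∀ n a, p (mono n a)) : p P :=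
  Finsupp.induction_linear (motive := p) P zero add mono

/-- The composition of differential operators, determined by `∂ ∘ b = b ∂ + ∂(b)`:
`(∑ aₙ ∂ⁿ) ∘ Q = ∑ aₙ (λ + ∂)ⁿ Q(λ)`, read at the level of symbols, `∂` acting on the coefficients
of the symbol `Q(λ)`. -/
def comp (P Q : DiffOp d) : DiffOp d :=
  act (Algebra.lsmul 𝔽 𝔽 (LPoly A)).toRingHom (varAdd d) P Q

theorem comp_mono (n : ℕ) (a : A) (Q : DiffOp d) :
    comp (mono n a) Q = a • ((varAdd d ^ n) Q : LPoly A) := by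
  rw [comp, act_mono]; rfl

theorem act_smul {S : Type*} [Semiring S] (f : A →+* S) (T : S) (a : A) (Q : DiffOp d) :
    act f T (a • Q) = f a * act f T Q := by
  induction Q using DiffOp.induction with
  | zero => simp
  | add P Q hP hQ => simp only [smul_add, map_add, hP, hQ, mul_add]
  | mono n b =>
    have : a • (mono n b : DiffOp d) = mono n (a * b) := Finsupp.smul_single _ _ _
    rw [this, act_mono, act_mono, map_mul, mul_assoc]

theorem act_comp {S : Type*} [Semiring S] (f : A →+* S) (T : S)
    (h : ∀ a, T * f a = f a * T + f (d a)) (P Q : DiffOp d) :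
    act f T (comp P Q) = act f T P * act f T Q := by
  have key : ∀ Q : DiffOp d, act f T (show DiffOp d from varAdd d (show LPoly A from Q)) = T * act f T Q := by
    intro Q
    induction Q using DiffOp.induction with
    | zero =>
      rw [map_zero, mul_zero]
      exact (congrArg _ (map_zero (varAdd d))).trans (map_zero _)
    | add P Q hP hQ =>
      rw [map_add, mul_add, ← hP, ← hQ, ← map_add]
      exact congrArg _ (map_add (varAdd d) P Q)
    | mono n b =>
      have : (show DiffOp d from varAdd d (show LPoly A from (mono n b : DiffOp d))) =
          mono (n + 1) b + mono n (d b) :=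
        varAdd_single d n b
      rw [this, map_add, act_mono, act_mono, act_mono, ← mul_assoc, h, pow_succ', add_mul,
        mul_assoc]
  have key' : ∀ (n : ℕ) (Q : DiffOp d),
      act f T (show DiffOp d from (varAdd d ^ n) (show LPoly A from Q)) = T ^ n * act f T Q := by
    intro n Q
    induction n with
    | zero => rw [pow_zero, pow_zero, one_mul]; rfl
    | succ n ih => rw [pow_succ', pow_succ', mul_assoc, ← ih, ← key]; rfl
  induction P using DiffOp.induction with
  | zero =>
    rw [map_zero, zero_mul]; simp only [comp, map_zero]; exact map_zero (act f T)
  | add P P' hP hP' =>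
    rw [map_add, add_mul, ← hP, ← hP', ← map_add]; congr 1; simp only [comp, map_add]; rfl
  | mono n a =>
    rw [comp_mono, act_mono, mul_assoc, ← key']
    exact act_smul f T a _

instance : One (DiffOp d) := ⟨mono 0 1⟩
instance : Mul (DiffOp d) := ⟨comp⟩

theorem one_def : (1 : DiffOp d) = mono 0 1 := rfl

theorem mul_def (P Q : DiffOp d) : P * Q = comp P Q := rfl

theorem mono_zero_mul (a : A) (Q : DiffOp d) : mono 0 a * Q = a • Q := by
  rw [mul_def, comp_mono, pow_zero]; rfl

theorem lsmul_commute (a : A) :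
    varAdd d * (Algebra.lsmul 𝔽 𝔽 (LPoly A)).toRingHom a =
      (Algebra.lsmul 𝔽 𝔽 (LPoly A)).toRingHom a * varAdd d +
        (Algebra.lsmul 𝔽 𝔽 (LPoly A)).toRingHom (d a) :=
  LinearMap.ext fun p => varAdd_smul d a p

instance : Ring (DiffOp d) where
  left_distrib P Q Q' := by
    simp only [mul_def, comp]; exact map_add _ _ _
  right_distrib P P' Q := by
    simp only [mul_def, comp, map_add]; rfl
  zero_mul Q := by simp only [mul_def, comp, map_zero]; rfl
  mul_zero P := by simp only [mul_def, comp]; exact map_zero _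
  mul_assoc P Q W := by
    simp only [mul_def]
    exact congrArg (fun g : Module.End 𝔽 (LPoly A) => g W)
      (act_comp (Algebra.lsmul 𝔽 𝔽 (LPoly A)).toRingHom (varAdd d) lsmul_commute P Q)
  one_mul P := by rw [one_def, mono_zero_mul, one_smul]
  mul_one P := by
    induction P using DiffOp.induction with
    | zero => simp only [mul_def, comp, map_zero]; rfl
    | add P Q hP hQ =>
      have : (P + Q) * 1 = P * 1 + Q * 1 := by simp only [mul_def, comp, map_add]; rfl
      rw [this, hP, hQ]
    | mono n a =>
      have : ∀ n, (varAdd d ^ n) (Finsupp.single 0 (1 : A)) = Finsupp.single n 1 := by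
        intro n
        induction n with
        | zero => simp
        | succ n ih => rw [pow_succ', Module.End.mul_apply, ih, varAdd_single]; simp
      rw [mul_def, comp_mono]
      refine (congrArg (a • ·) (this n)).trans ((Finsupp.smul_single _ _ _).trans ?_)
      rw [smul_eq_mul, mul_one]; rfl
  add_assoc := add_assoc
  zero_add := zero_add
  add_zero := add_zero
  add_comm := add_comm
  nsmul := (inferInstance : AddCommGroup (DiffOp d)).nsmul
  nsmul_zero := (inferInstance : AddCommGroup (DiffOp d)).nsmul_zero
  nsmul_succ := (inferInstance : AddCommGroup (DiffOp d)).nsmul_succ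
  zsmul := (inferInstance : AddCommGroup (DiffOp d)).zsmul
  zsmul_zero' := (inferInstance : AddCommGroup (DiffOp d)).zsmul_zero'
  zsmul_succ' := (inferInstance : AddCommGroup (DiffOp d)).zsmul_succ'
  zsmul_neg' := (inferInstance : AddCommGroup (DiffOp d)).zsmul_neg'
  sub_eq_add_neg := sub_eq_add_neg
  neg_add_cancel := neg_add_cancel

/-- The inclusion `A → A[∂]`. -/
def ofFun : A →+* DiffOp d where
  toFun a := mono 0 a
  map_one' := rfl
  map_mul' a b := by rw [mono_zero_mul]; exact (Finsupp.smul_single a 0 b).symm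
  map_zero' := Finsupp.single_zero _
  map_add' _ _ := Finsupp.single_add _ _ _

variable (d) in
/-- The generator `∂` of `A[∂]`. -/
def del : DiffOp d := mono 1 1

theorem ofFun_mul (a : A) (Q : DiffOp d) : ofFun a * Q = a • Q := mono_zero_mul a Q

/-- The defining relation `∂ ∘ a = a ∂ + ∂(a)` of `A[∂]`. -/
theorem del_mul_ofFun (a : A) : del d * ofFun a = ofFun a * del d + ofFun (d a) := by
  rw [ofFun_mul, mul_def, del, comp_mono, pow_one, one_smul]
  refine (varAdd_single d 0 a).trans ?_
  have : a • (mono 1 1 : DiffOp d) = mono 1 (a * 1) := Finsupp.smul_single _ _ _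
  rw [this, mul_one]; rfl

instance : IsScalarTower A (DiffOp d) (DiffOp d) where
  smul_assoc a P Q := by simp only [smul_eq_mul, ← ofFun_mul, mul_assoc]

instance : IsScalarTower 𝔽 (DiffOp d) (DiffOp d) where
  smul_assoc c P Q := by
    rw [← algebraMap_smul A c P, ← algebraMap_smul A c (P • Q), smul_assoc]

/-- A ring homomorphism out of `A[∂]` is given by the images of `A` and of `∂`. -/
def lift {S : Type*} [Semiring S] (f : A →+* S) (T : S) (h : ∀ a, T * f a = f a * T + f (d a)) :
    DiffOp d →+* S where
  toFun := act f T
  map_one' := by rw [one_def, act_mono, map_one, pow_zero, mul_one]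
  map_mul' := act_comp f T h
  map_zero' := map_zero _
  map_add' := map_add _

theorem smul_one_comm (c : 𝔽) (P : DiffOp d) : P * (c • 1) = c • P := by
  have h1 : (c • 1 : DiffOp d) = ofFun (algebraMap 𝔽 A c) := by
    rw [← mul_one (ofFun (algebraMap 𝔽 A c)), ofFun_mul, algebraMap_smul]
  have h2 : ∀ n, (varAdd d ^ n) (Finsupp.single 0 (algebraMap 𝔽 A c)) =
      Finsupp.single n (algebraMap 𝔽 A c) := by
    intro n
    induction n with
    | zero => simp
    | succ n ih => rw [pow_succ', Module.End.mul_apply, ih, varAdd_single]; simp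
  rw [h1]
  induction P using DiffOp.induction with
  | zero => simp
  | add P Q hP hQ => rw [add_mul, hP, hQ, smul_add]
  | mono n a =>
    rw [mul_def, comp_mono]
    refine (congrArg (a • ·) (h2 n)).trans ?_
    rw [← algebraMap_smul A c]
    refine (Finsupp.smul_single _ _ _).trans ((Finsupp.smul_single _ _ _).trans ?_).symm
    rw [smul_eq_mul, smul_eq_mul, mul_comm]

section Module

variable (d) (E : Type*) [AddCommGroup E] [Module 𝔽 E] [Module (DiffOp d) E]
  [IsScalarTower 𝔽 (DiffOp d) E]

/-- The action of `∂` on an `A[∂]`-module. -/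
def delEnd : Module.End 𝔽 E where
  toFun e := del d • e
  map_add' := smul_add _
  map_smul' c e := by
    rw [RingHom.id_apply, ← smul_assoc c (del d) e, ← smul_one_comm, mul_smul, smul_assoc,
      one_smul]

end Module

end DiffOp

/-- The space `CDer(A)` of conformal derivations of a differential algebra `(A, ∂)`: the linear
maps `φ_λ : A → A[λ]` with `φ_λ(∂a) = (∂ + λ) φ_λ(a)` and `φ_λ(ab) = φ_λ(a) b + a φ_λ(b)`. -/
def CDer {𝔽 A : Type*} [Field 𝔽] [CommRing A] [Algebra 𝔽 A] (d : Derivation 𝔽 A A) :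
    Submodule 𝔽 (A →ₗ[𝔽] LPoly A) where
  carrier := {φ | (∀ a, φ (d a) = LPoly.varAdd d (φ a)) ∧ ∀ a b, φ (a * b) = b • φ a + a • φ b}
  zero_mem' := by simp
  add_mem' := by
    rintro φ ψ ⟨h1, h2⟩ ⟨h3, h4⟩
    refine ⟨fun a => by simp [h1, h3], fun a b => ?_⟩
    simp only [LinearMap.add_apply, h2, h4, smul_add]; abel
  smul_mem' := by
    rintro c φ ⟨h1, h2⟩
    refine ⟨fun a => by simp [h1], fun a b => ?_⟩
    simp only [LinearMap.smul_apply, h2, smul_add, smul_comm c]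

namespace CDer

open LPoly

variable {𝔽 A : Type*} [Field 𝔽] [CommRing A] [Algebra 𝔽 A] {d : Derivation 𝔽 A A}

/-- The action `(a φ)_λ = (|_{x = ∂} a) φ_{λ + x}` of `a ∈ A` on `CDer(A)`. -/
def smulFun (a : A) (φ : CDer d) : CDer d :=
  ⟨(shiftMul d a).restrictScalars 𝔽 ∘ₗ φ.1, fun b => by
      simp [φ.2.1, shiftMul_varAdd], fun b c => by
      simp [φ.2.2]⟩

/-- The action `(∂ φ)_λ = - λ φ_λ` of `∂` on `CDer(A)`. -/
def delFun (φ : CDer d) : CDer d :=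
  ⟨-(mulVar 𝔽 ∘ₗ φ.1), fun b => by
      simp [φ.2.1, varAdd_mulVar], fun b c => by
      simp only [LinearMap.neg_apply, LinearMap.comp_apply, φ.2.2, map_add, mulVar_smul, smul_neg]
      abel⟩

variable (d) in
/-- The ring homomorphism `A → End (CDer(A))` given by the action of `A`. -/
def smulHom : A →+* AddMonoid.End (CDer d) where
  toFun a := ⟨⟨smulFun a, by ext1; simp [smulFun]⟩, fun φ ψ => by
    ext1; simp [smulFun, LinearMap.comp_add]⟩
  map_one' := by
    exact AddMonoidHom.ext fun φ => Subtype.ext (LinearMap.ext fun b => shiftMul_one d _)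
  map_mul' a b := by
    exact AddMonoidHom.ext fun φ => Subtype.ext (LinearMap.ext fun c => shiftMul_mul d a b _)
  map_zero' := by
    refine AddMonoidHom.ext fun φ => Subtype.ext (LinearMap.ext fun c => ?_)
    exact congrArg (fun g : LPoly A →ₗ[A] LPoly A => g (φ.1 c)) (shiftMul_zero d)
  map_add' a b := by
    refine AddMonoidHom.ext fun φ => Subtype.ext (LinearMap.ext fun c => ?_)
    exact congrArg (fun g : LPoly A →ₗ[A] LPoly A => g (φ.1 c)) (shiftMul_add d a b)

variable (d) in
/-- The additive endomorphism of `CDer(A)` given by the action of `∂`. -/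
def delHom : AddMonoid.End (CDer d) :=
  ⟨⟨delFun, by ext1; simp [delFun]⟩, fun φ ψ => by
    ext1; simp [delFun, LinearMap.comp_add, add_comm]⟩

/-- The left `A[∂]`-module structure of `CDer(A)`, determined by the actions of `A` and `∂`. -/
instance : Module (DiffOp d) (CDer d) :=
  Module.compHom (CDer d) (DiffOp.lift (d := d) (smulHom d) (delHom d) fun a => by
    refine AddMonoidHom.ext fun φ => Subtype.ext (LinearMap.ext fun b => ?_)
    change -(mulVar 𝔽 (shiftMul d a (φ.1 b))) =
      shiftMul d a (-(mulVar 𝔽 (φ.1 b))) + shiftMul d (d a) (φ.1 b)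
    rw [map_neg, shiftMul_mulVar]; abel)

theorem ofFun_smul (a : A) (φ : CDer d) : (DiffOp.ofFun a : DiffOp d) • φ = smulFun a φ := by
  change DiffOp.act (smulHom d) (delHom d) (DiffOp.mono 0 a) φ = _
  rw [DiffOp.act_mono, pow_zero, mul_one]; rfl

theorem del_smul (φ : CDer d) : DiffOp.del d • φ = delFun φ := by
  change DiffOp.act (smulHom d) (delHom d) (DiffOp.mono 1 1) φ = _
  rw [DiffOp.act_mono, pow_one, map_one, one_mul]; rfl

end CDer

section Jet

variable (𝔽 R : Type*) [Field 𝔽] [CommRing R] [Algebra 𝔽 R]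

open MvPolynomial

/-- The derivation `xᵣ⁽ⁿ⁾ ↦ xᵣ⁽ⁿ⁺¹⁾` of the algebra of differential polynomials in the variables
`xᵣ = xᵣ⁽⁰⁾`, one for each element `r` of `R`. -/
def Jet.polyDeriv : Derivation 𝔽 (MvPolynomial (R × ℕ) 𝔽) (MvPolynomial (R × ℕ) 𝔽) :=
  mkDerivation 𝔽 fun p => X (p.1, p.2 + 1)

/-- The differential ideal generated by the polynomial relations `p` between the elements of `R`,
that is by the kernel `I` of `𝔽[xᵣ : r ∈ R] → R`. -/
def Jet.ideal : Ideal (MvPolynomial (R × ℕ) 𝔽) :=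
  Ideal.span {q | ∃ (n : ℕ) (p : MvPolynomial R 𝔽), aeval (id : R → R) p = 0 ∧
    q = (Jet.polyDeriv 𝔽 R)^[n] (rename (fun r => (r, 0)) p)}

/-- The jet algebra `J_∞ R` of `R`: from the presentation `R = 𝔽[xᵣ : r ∈ R] / I`, the quotient of
the algebra of differential polynomials by the differential ideal generated by `I`. -/
abbrev Jet : Type _ := MvPolynomial (R × ℕ) 𝔽 ⧸ Jet.ideal 𝔽 R

namespace Jet

theorem polyDeriv_mem {q : MvPolynomial (R × ℕ) 𝔽} (hq : q ∈ ideal 𝔽 R) :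
    polyDeriv 𝔽 R q ∈ ideal 𝔽 R := by
  refine Submodule.span_induction ?_ ?_ ?_ ?_ hq
  · rintro _ ⟨n, p, hp, rfl⟩
    refine Ideal.subset_span ⟨n + 1, p, hp, ?_⟩
    rw [Function.iterate_succ_apply']
  · rw [map_zero]; exact Ideal.zero_mem _
  · intro x y _ _ hx hy
    rw [map_add]; exact Ideal.add_mem _ hx hy
  · intro a x hx' hx
    rw [smul_eq_mul, Derivation.leibniz, smul_eq_mul, smul_eq_mul]
    exact Ideal.add_mem _ (Ideal.mul_mem_left _ _ hx) (Ideal.mul_mem_right _ _ hx')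

/-- The derivation `∂` of the jet algebra. -/
def deriv : Derivation 𝔽 (Jet 𝔽 R) (Jet 𝔽 R) :=
  Derivation.liftOfSurjective (f := Ideal.Quotient.mkₐ 𝔽 (ideal 𝔽 R)) (d := polyDeriv 𝔽 R)
    (Ideal.Quotient.mkₐ_surjective 𝔽 _) fun q hq => by
      rw [Ideal.Quotient.mkₐ_eq_mk, Ideal.Quotient.eq_zero_iff_mem] at hq ⊢
      exact polyDeriv_mem 𝔽 R hq

theorem deriv_mk (q : MvPolynomial (R × ℕ) 𝔽) :
    deriv 𝔽 R (Ideal.Quotient.mk _ q) = Ideal.Quotient.mk _ (polyDeriv 𝔽 R q) :=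
  Derivation.liftOfSurjective_apply (f := Ideal.Quotient.mkₐ 𝔽 (ideal 𝔽 R)) (d := polyDeriv 𝔽 R)
    (Ideal.Quotient.mkₐ_surjective 𝔽 _) (fun q hq => by
      rw [Ideal.Quotient.mkₐ_eq_mk, Ideal.Quotient.eq_zero_iff_mem] at hq ⊢
      exact polyDeriv_mem 𝔽 R hq) q

theorem mk_rename {p q : MvPolynomial R 𝔽} (h : aeval (id : R → R) p = aeval (id : R → R) q) :
    (Ideal.Quotient.mk (ideal 𝔽 R) (rename (fun r => (r, 0)) p)) =
      Ideal.Quotient.mk (ideal 𝔽 R) (rename (fun r => (r, 0)) q) := by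
  rw [Ideal.Quotient.eq, ← map_sub]
  exact Ideal.subset_span ⟨0, p - q, by rw [map_sub, h, sub_self], rfl⟩

/-- The canonical homomorphism `R → J_∞ R`, `r ↦ xᵣ`. -/
def ι : R →ₐ[𝔽] Jet 𝔽 R where
  toFun r := Ideal.Quotient.mk _ (X (r, 0))
  map_one' := by simpa using mk_rename 𝔽 R (p := X 1) (q := 1) (by simp)
  map_mul' r s := by
    have := mk_rename 𝔽 R (p := X (r * s)) (q := X r * X s) (by simp)
    rwa [map_mul, rename_X, rename_X, rename_X, map_mul] at this
  map_zero' := by simpa using mk_rename 𝔽 R (p := X 0) (q := 0) (by simp)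
  map_add' r s := by
    have := mk_rename 𝔽 R (p := X (r + s)) (q := X r + X s) (by simp)
    rwa [map_add, rename_X, rename_X, rename_X, map_add] at this
  commutes' c := by
    have := mk_rename 𝔽 R (p := X (algebraMap 𝔽 R c)) (q := C c) (by simp)
    rw [rename_X, rename_C] at this
    exact this

theorem deriv_iterate_ι (r : R) (n : ℕ) :
    (deriv 𝔽 R)^[n] (ι 𝔽 R r) = Ideal.Quotient.mk _ (X (r, n)) := by
  induction n with
  | zero => rfl
  | succ n ih =>
    rw [Function.iterate_succ_apply', ih, deriv_mk, polyDeriv, mkDerivation_X]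

/-- The universal property that characterizes the jet algebra: a homomorphism from `R` to a
differential algebra extends uniquely to a homomorphism of differential algebras from `J_∞ R`. -/
theorem existsUnique_lift {B : Type*} [CommRing B] [Algebra 𝔽 B] (dB : Derivation 𝔽 B B)
    (f : R →ₐ[𝔽] B) :
    ∃! g : Jet 𝔽 R →ₐ[𝔽] B, (∀ x, g (deriv 𝔽 R x) = dB (g x)) ∧ ∀ r, g (ι 𝔽 R r) = f r := by
  let G : MvPolynomial (R × ℕ) 𝔽 →ₐ[𝔽] B := aeval fun p => dB^[p.2] (f p.1)
  have hG : ∀ q, G (polyDeriv 𝔽 R q) = dB (G q) := by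
    intro q
    induction q using MvPolynomial.induction_on with
    | C c => simp only [derivation_C, map_zero, algHom_C, Derivation.map_algebraMap]
    | add p q hp hq => simp only [map_add, hp, hq]
    | mul_X p i hp =>
      have : G (polyDeriv 𝔽 R (X i)) = dB (G (X i)) := by
        simp only [polyDeriv, mkDerivation_X, G, aeval_X, Function.iterate_succ_apply']
      simp only [Derivation.leibniz, map_add, smul_eq_mul, map_mul, hp, this]
  have hker : ∀ q ∈ ideal 𝔽 R, G q = 0 := by
    intro q hq
    have hle : ideal 𝔽 R ≤ RingHom.ker G := by
      refine Ideal.span_le.2 ?_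
      rintro _ ⟨n, p, hp, rfl⟩
      have h0 : G (rename (fun r => (r, 0)) p) = f (aeval (id : R → R) p) := by
        have : G.comp (rename fun r => (r, 0)) = f.comp (aeval (id : R → R)) :=
          MvPolynomial.algHom_ext fun r => by simp [G]
        exact congrArg (fun g : MvPolynomial R 𝔽 →ₐ[𝔽] B => g p) this
      have hn : ∀ (n : ℕ) (q), G q = 0 → G ((polyDeriv 𝔽 R)^[n] q) = 0 := by
        intro n
        induction n with
        | zero => exact fun q h => h
        | succ n ih => exact fun q h => ih _ (by rw [hG, h, map_zero])
      exact hn n _ (by rw [h0, hp, map_zero])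
    exact hle hq
  refine ⟨Ideal.Quotient.liftₐ _ G hker, ⟨fun x => ?_, fun r => ?_⟩, fun g hg => ?_⟩
  · obtain ⟨q, rfl⟩ := Ideal.Quotient.mk_surjective x
    rw [deriv_mk]
    exact hG q
  · change G (X (r, 0)) = f r
    simp [G]
  · refine Ideal.Quotient.algHom_ext _ (MvPolynomial.algHom_ext fun p => ?_)
    have hn : ∀ n : ℕ, ∀ x, g ((deriv 𝔽 R)^[n] x) = dB^[n] (g x) := by
      intro n
      induction n with
      | zero => exact fun x => rfl
      | succ n ih => intro x; rw [Function.iterate_succ_apply, ih, hg.1,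
          ← Function.iterate_succ_apply]
    change g (Ideal.Quotient.mk _ (X (p.1, p.2))) = G (X p)
    rw [← deriv_iterate_ι, hn, hg.2]
    simp [G]

variable {𝔽 R} in
/-- `φ` is the conformal lift of the derivation `D` of `R` if `φ_λ ∘ ι = ι ∘ D`. -/
def IsConformalLift (D : Derivation 𝔽 R R) (φ : CDer (deriv 𝔽 R)) : Prop :=
  ∀ r, φ.1 (ι 𝔽 R r) = LPoly.const (ι 𝔽 R (D r))

/-- The right `R`-module structure of `J_∞ R[∂]`, by composition on the right with elements
of `R`. -/
instance : Module R (DiffOp (deriv 𝔽 R)) where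
  smul r P := P * DiffOp.ofFun (ι 𝔽 R r)
  one_smul P := by change P * _ = P; rw [map_one, map_one, mul_one]
  mul_smul r s P := by
    change P * _ = P * _ * _
    rw [mul_comm r s, map_mul, map_mul, mul_assoc]
  smul_zero r := zero_mul _
  smul_add r P Q := add_mul _ _ _
  add_smul r s P := by change P * _ = P * _ + P * _; rw [map_add, map_add, mul_add]
  zero_smul P := by change P * _ = 0; rw [map_zero, map_zero, mul_zero]

theorem right_smul_def (r : R) (P : DiffOp (deriv 𝔽 R)) :
    r • P = P * DiffOp.ofFun (ι 𝔽 R r) := rfl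

instance : SMulCommClass R (DiffOp (deriv 𝔽 R)) (DiffOp (deriv 𝔽 R)) where
  smul_comm r P Q := by simp only [right_smul_def, smul_eq_mul, mul_assoc]

instance : SMulCommClass R (Jet 𝔽 R) (DiffOp (deriv 𝔽 R)) where
  smul_comm r a Q := by simp only [right_smul_def, ← DiffOp.ofFun_mul, mul_assoc]

instance : SMulCommClass R 𝔽 (DiffOp (deriv 𝔽 R)) where
  smul_comm r c Q := by simp only [right_smul_def, smul_mul_assoc]

end Jet

/-- The `J_∞ R[∂]`-module `J_∞ R[∂] ⊗_R F`. -/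
abbrev CurrentModule (F : Type*) [AddCommGroup F] [Module R F] : Type _ :=
  DiffOp (Jet.deriv 𝔽 R) ⊗[R] F

end Jet

open LPoly in
/-- A Lie conformal algebra structure on an `𝔽[∂]`-module `E`, where `T` is the action of `∂`. -/
@[ext]
structure LieConformalAlgebra (𝔽 E : Type*) [Field 𝔽] [AddCommGroup E] [Module 𝔽 E]
    (T : Module.End 𝔽 E) where
  /-- The bracket `[u_λ v]`. -/
  bracket : E →ₗ[𝔽] E →ₗ[𝔽] LPoly E
  /-- `[∂u_λ v] = - λ [u_λ v]` -/
  bracket_del_left : ∀ u v, bracket (T u) v = -mulVar 𝔽 (bracket u v)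
  /-- `[u_λ ∂v] = (∂ + λ) [u_λ v]` -/
  bracket_del_right : ∀ u v, bracket u (T v) = map 𝔽 T (bracket u v) + mulVar 𝔽 (bracket u v)
  /-- `[v_λ u] = - (|_{x = ∂} [u_{- λ - x} v])` -/
  skew : ∀ u v, bracket v u = -subst (-mulVar 𝔽 - map 𝔽 T) const (bracket u v)
  /-- `[u_λ [v_μ w]] - [v_μ [u_λ w]] = [[u_λ v]_{λ + μ} w]` -/
  jacobi : ∀ u v w,
    subst (var₂ 𝔽) (fun e => subst (var₁ 𝔽) const₂ (bracket u e)) (bracket v w) -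
        subst (var₁ 𝔽) (fun e => subst (var₂ 𝔽) const₂ (bracket v e)) (bracket u w) =
      subst (var₁ 𝔽) (fun e => subst (var₁ 𝔽 + var₂ 𝔽) const₂ (bracket e w)) (bracket u v)

section LCAd

variable {𝔽 A : Type*} [Field 𝔽] [CommRing A] [Algebra 𝔽 A] (d : Derivation 𝔽 A A)
  (E : Type*) [AddCommGroup E] [Module 𝔽 E] [Module A E] [Module (DiffOp d) E]
  [IsScalarTower 𝔽 A E] [IsScalarTower 𝔽 (DiffOp d) E] [IsScalarTower A (DiffOp d) E]

open LPoly in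
/-- A Lie conformal algebroid structure on a left `A[∂]`-module `E`. -/
@[ext]
structure LieConformalAlgebroid extends LieConformalAlgebra 𝔽 E (DiffOp.delEnd d E) where
  /-- The anchor map `θ`. -/
  anchor : E →ₗ[DiffOp d] CDer d
  /-- `[u_λ av] = θ(u)_λ(a) v + a [u_λ v]` -/
  leibniz : ∀ (u : E) (a : A) (v : E), bracket u (a • v) =
    map 𝔽 ((LinearMap.toSpanSingleton A E v).restrictScalars 𝔽) ((anchor u).1 a) +
      a • bracket u v
  /-- `θ([u_λ v])_μ(a) = θ(u)_λ(θ(v)_{μ - λ}(a)) - θ(v)_{μ - λ}(θ(u)_λ(a))` -/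
  anchor_bracket : ∀ (u v : E) (a : A),
    subst (var₁ 𝔽) (fun e => subst (var₂ 𝔽) const₂ ((anchor e).1 a)) (bracket u v) =
      subst (var₂ 𝔽 - var₁ 𝔽) (fun b => subst (var₁ 𝔽) const₂ ((anchor u).1 b)) ((anchor v).1 a) -
        subst (var₁ 𝔽) (fun b => subst (var₂ 𝔽 - var₁ 𝔽) const₂ ((anchor v).1 b))
          ((anchor u).1 a)

/-- The algebra `A / A∂A`. -/
abbrev QuotAlg : Type _ := A ⧸ Ideal.span (Set.range d)

/-- The submodule `A∂E` of an `A[∂]`-module `E`. -/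
def delSpan : Submodule A E := Submodule.span A (Set.range fun e : E => DiffOp.del d • e)

end LCAd

namespace LPoly

variable {𝔽 E V W : Type*} [Field 𝔽] [AddCommGroup E] [Module 𝔽 E] [AddCommGroup V] [Module 𝔽 V]
  [AddCommGroup W]

theorem apply_subst (π : V →+ W) (T : Module.End 𝔽 V) (hT : ∀ x, π (T x) = 0) (j : E → V)
    (hj : j 0 = 0) (p : LPoly E) : π (subst T j p) = π (j (p 0)) := by
  rw [subst, Finsupp.sum, map_sum]
  refine (Finset.sum_eq_single 0 (fun n _ hn => ?_) fun h => ?_).trans ?_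
  · obtain ⟨n, rfl⟩ := Nat.exists_eq_succ_of_ne_zero hn
    rw [Nat.succ_eq_add_one, pow_succ', Module.End.mul_apply, hT]
  · rw [Finsupp.notMem_support_iff] at h
    rw [h, hj, map_zero, map_zero]
  · rw [pow_zero, Module.End.one_apply]

/-- The coefficient of `λ⁰ μ⁰`. -/
def coeff₂ : LPoly (LPoly E) →+ E :=
  (Finsupp.applyAddHom 0).comp (Finsupp.applyAddHom (M := LPoly E) 0)

theorem coeff₂_const₂ (e : E) : coeff₂ (const₂ e) = e := by
  simp [coeff₂, const₂, const]

theorem const₂_zero : const₂ (0 : E) = 0 := by simp [const₂, const]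

theorem coeff₂_var₁ (x : LPoly (LPoly E)) : coeff₂ (var₁ 𝔽 x) = 0 :=
  mulVar_apply_zero 𝔽 (x 0)

theorem coeff₂_var₂ (x : LPoly (LPoly E)) : coeff₂ (var₂ 𝔽 x) = 0 := by
  have : var₂ 𝔽 x 0 = 0 := mulVar_apply_zero 𝔽 x
  simp [coeff₂, this]

theorem subst_zero_right (T : Module.End 𝔽 V) (j : E → V) : subst T j 0 = 0 := by
  simp [subst]

theorem skew_apply_zero (T : Module.End 𝔽 E) (p : LPoly E) :
    ∃ w, subst (-mulVar 𝔽 - map 𝔽 T) const p 0 = p 0 + T w := by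
  induction p using Finsupp.induction_linear with
  | zero => exact ⟨0, by simp [subst_zero_right]⟩
  | add p q hp hq =>
    obtain ⟨v, hv⟩ := hp
    obtain ⟨w, hw⟩ := hq
    refine ⟨v + w, ?_⟩
    have : subst (-mulVar 𝔽 - map 𝔽 T) const (p + q) =
        subst (-mulVar 𝔽 - map 𝔽 T) const p + subst (-mulVar 𝔽 - map 𝔽 T) const q :=
      Finsupp.sum_add_index' (by simp [const]) (by simp [const])
    rw [this, Finsupp.add_apply, hv, hw, map_add, Finsupp.add_apply]; abel
  | single n e =>
    have h : subst (-mulVar 𝔽 - map 𝔽 T) const (Finsupp.single n e) =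
        ((-mulVar 𝔽 - map 𝔽 T : Module.End 𝔽 (LPoly E)) ^ n) (const e) := Finsupp.sum_single_index (by simp [const])
    rw [h]
    cases n with
    | zero => exact ⟨0, by simp [const]⟩
    | succ n =>
      refine ⟨-((((-mulVar 𝔽 - map 𝔽 T : Module.End 𝔽 (LPoly E)) ^ n) (const e)) 0), ?_⟩
      rw [pow_succ', Module.End.mul_apply, LinearMap.sub_apply, Finsupp.sub_apply,
        LinearMap.neg_apply, Finsupp.neg_apply, mulVar_apply_zero, map_apply]
      simp

theorem shiftMul_apply_zero {A : Type*} [CommRing A] [Algebra 𝔽 A] (d : Derivation 𝔽 A A) (a : A)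
    (p : LPoly A) : shiftMul d a p 0 - a * p 0 ∈ Ideal.span (Set.range d) := by
  induction p using Finsupp.induction_linear with
  | zero => simp
  | add p q hp hq =>
    have : shiftMul d a (p + q) 0 - a * (p + q) 0 =
        (shiftMul d a p 0 - a * p 0) + (shiftMul d a q 0 - a * q 0) := by
      rw [map_add, Finsupp.add_apply, Finsupp.add_apply]; ring
    rw [this]
    exact Ideal.add_mem _ hp hq
  | single n c =>
    rw [shiftMul_single]
    cases n with
    | zero => simp [const, mul_comm]
    | succ n =>
      have h : ∀ q : LPoly A, varAdd d q 0 = d (q 0) := fun q => by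
        rw [varAdd, LinearMap.add_apply, Finsupp.add_apply, mulVar_apply_zero, zero_add]; rfl
      rw [pow_succ', Module.End.mul_apply, Finsupp.smul_apply, h, Finsupp.single_eq_of_ne (by simp),
        mul_zero, sub_zero]
      exact Ideal.mul_mem_left _ _ (Ideal.subset_span ⟨_, rfl⟩)

end LPoly

section Quotient

variable {𝔽 A : Type*} [Field 𝔽] [CommRing A] [Algebra 𝔽 A] {d : Derivation 𝔽 A A}
  {E : Type*} [AddCommGroup E] [Module 𝔽 E] [Module A E] [Module (DiffOp d) E]
  [IsScalarTower 𝔽 A E] [IsScalarTower 𝔽 (DiffOp d) E] [IsScalarTower A (DiffOp d) E]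

/-- The module `Ē = E / A∂E` underlying the quotient Lie algebroid of a Lie conformal algebroid. -/
def QuotMod (_ : LieConformalAlgebroid d E) : Type _ := E ⧸ delSpan d E

namespace LieConformalAlgebroid

open LPoly

variable (S : LieConformalAlgebroid d E)

theorem del_mem (e : E) : DiffOp.del d • e ∈ delSpan d E := Submodule.subset_span ⟨e, rfl⟩

theorem bracket_mem_right (u : E) {v : E} (hv : v ∈ delSpan d E) :
    S.bracket u v 0 ∈ delSpan d E := by
  refine Submodule.span_induction ?_ ?_ ?_ ?_ hv
  · rintro _ ⟨e, rfl⟩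
    have := S.bracket_del_right u e
    change S.bracket u (DiffOp.delEnd d E e) 0 ∈ _
    rw [this, Finsupp.add_apply, mulVar_apply_zero, add_zero]
    exact del_mem _
  · simp
  · intro x y _ _ hx hy
    rw [map_add]; exact Submodule.add_mem _ hx hy
  · intro a x hx' hx
    rw [S.leibniz, Finsupp.add_apply]
    exact Submodule.add_mem _ (Submodule.smul_mem _ _ hx') (Submodule.smul_mem _ _ hx)

theorem bracket_add_mem (u v : E) : S.bracket v u 0 + S.bracket u v 0 ∈ delSpan d E := by
  obtain ⟨w, hw⟩ := skew_apply_zero (DiffOp.delEnd d E) (S.bracket u v)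
  rw [S.skew u v, Finsupp.neg_apply, hw, neg_add, neg_add_cancel_comm]
  exact Submodule.neg_mem _ (del_mem w)

theorem bracket_mem_left {u : E} (v : E) (hu : u ∈ delSpan d E) :
    S.bracket u v 0 ∈ delSpan d E :=
  (Submodule.add_mem_iff_right _ (S.bracket_mem_right v hu)).1 (S.bracket_add_mem u v)

theorem anchor_smul (a : A) (u : E) (b : A) :
    (S.anchor (a • u)).1 b = shiftMul d a ((S.anchor u).1 b) := by
  have : a • u = (DiffOp.ofFun a : DiffOp d) • u := by
    rw [← one_smul (DiffOp d) u, ← smul_assoc, ← DiffOp.ofFun_mul, mul_one, one_smul]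
  rw [this, map_smul, CDer.ofFun_smul]; rfl

theorem anchor_smul_mem (a : A) (u : E) (b : A) :
    (S.anchor (a • u)).1 b 0 - a * (S.anchor u).1 b 0 ∈ Ideal.span (Set.range d) := by
  rw [anchor_smul]; exact shiftMul_apply_zero d a _

theorem anchor_mem_left {u : E} (a : A) (hu : u ∈ delSpan d E) :
    (S.anchor u).1 a 0 ∈ Ideal.span (Set.range d) := by
  refine Submodule.span_induction ?_ ?_ ?_ ?_ hu
  · rintro _ ⟨e, rfl⟩
    have : (S.anchor (DiffOp.del d • e)).1 a = -mulVar 𝔽 ((S.anchor e).1 a) := by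
      rw [map_smul, CDer.del_smul]; rfl
    rw [this, Finsupp.neg_apply, mulVar_apply_zero, neg_zero]
    exact Ideal.zero_mem _
  · rw [map_zero S.anchor]; exact Ideal.zero_mem _
  · intro x y _ _ hx hy
    rw [map_add S.anchor]; exact Ideal.add_mem _ hx hy
  · intro c x _ hx
    have := Ideal.add_mem _ (S.anchor_smul_mem c x a) (Ideal.mul_mem_left _ c hx)
    rwa [sub_add_cancel] at this

theorem anchor_mem_right (u : E) {a : A} (ha : a ∈ Ideal.span (Set.range d)) :
    (S.anchor u).1 a 0 ∈ Ideal.span (Set.range d) := by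
  refine Submodule.span_induction ?_ ?_ ?_ ?_ ha
  · rintro _ ⟨b, rfl⟩
    rw [(S.anchor u).2.1, varAdd, LinearMap.add_apply, Finsupp.add_apply, mulVar_apply_zero,
      zero_add]
    exact Ideal.subset_span ⟨_, rfl⟩
  · rw [map_zero (S.anchor u).1]; exact Ideal.zero_mem _
  · intro x y _ _ hx hy
    rw [map_add (S.anchor u).1]; exact Ideal.add_mem _ hx hy
  · intro c x hx' hx
    rw [smul_eq_mul, (S.anchor u).2.2]
    exact Ideal.add_mem _ (Ideal.mul_mem_right _ _ hx') (Ideal.mul_mem_left _ _ hx)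

theorem jacobi_zero (u v w : E) :
    S.bracket u (S.bracket v w 0) 0 =
      S.bracket (S.bracket u v 0) w 0 + S.bracket v (S.bracket u w 0) 0 := by
  have hs : ∀ x : LPoly (LPoly E),
      coeff₂ ((var₁ 𝔽 + var₂ 𝔽 : Module.End 𝔽 (LPoly (LPoly E))) x) = 0 := fun x => by
    rw [LinearMap.add_apply, map_add, coeff₂_var₁, coeff₂_var₂, add_zero]
  have h := congrArg coeff₂ (S.jacobi u v w)
  rw [map_sub, apply_subst coeff₂ _ coeff₂_var₂ _ (by rw [map_zero, subst_zero_right]),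
    apply_subst coeff₂ _ coeff₂_var₁ const₂ const₂_zero,
    apply_subst coeff₂ _ coeff₂_var₁ _ (by rw [map_zero, subst_zero_right]),
    apply_subst coeff₂ _ coeff₂_var₂ const₂ const₂_zero,
    apply_subst coeff₂ _ coeff₂_var₁ _
      (by rw [map_zero, LinearMap.zero_apply, subst_zero_right]),
    apply_subst coeff₂ _ hs const₂ const₂_zero, coeff₂_const₂, coeff₂_const₂, coeff₂_const₂] at h
  rw [← h, sub_add_cancel]

theorem anchor_bracket_zero (u v : E) (a : A) :
    (S.anchor (S.bracket u v 0)).1 a 0 =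
      (S.anchor u).1 ((S.anchor v).1 a 0) 0 - (S.anchor v).1 ((S.anchor u).1 a 0) 0 := by
  have hs : ∀ x : LPoly (LPoly A),
      coeff₂ ((var₂ 𝔽 - var₁ 𝔽 : Module.End 𝔽 (LPoly (LPoly A))) x) = 0 := fun x => by
    rw [LinearMap.sub_apply, map_sub, coeff₂_var₁, coeff₂_var₂, sub_zero]
  have h0 : subst (var₂ 𝔽) const₂ ((S.anchor 0).1 a) = 0 := by
    rw [map_zero S.anchor]; exact subst_zero_right _ _
  have h := congrArg coeff₂ (S.anchor_bracket u v a)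
  rw [map_sub, apply_subst coeff₂ _ coeff₂_var₁ _ h0,
    apply_subst coeff₂ _ coeff₂_var₂ const₂ const₂_zero,
    apply_subst coeff₂ _ hs _ (by rw [map_zero, subst_zero_right]),
    apply_subst coeff₂ _ coeff₂_var₁ const₂ const₂_zero,
    apply_subst coeff₂ _ coeff₂_var₁ _ (by rw [map_zero, subst_zero_right]),
    apply_subst coeff₂ _ hs const₂ const₂_zero, coeff₂_const₂, coeff₂_const₂, coeff₂_const₂] at h
  exact h

end LieConformalAlgebroid

namespace QuotMod

variable (S : LieConformalAlgebroid d E)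

instance : AddCommGroup (QuotMod S) := inferInstanceAs (AddCommGroup (E ⧸ delSpan d E))
instance : Module A (QuotMod S) := inferInstanceAs (Module A (E ⧸ delSpan d E))
instance : Module 𝔽 (QuotMod S) := inferInstanceAs (Module 𝔽 (E ⧸ delSpan d E))
instance : IsScalarTower 𝔽 A (QuotMod S) :=
  inferInstanceAs (IsScalarTower 𝔽 A (E ⧸ delSpan d E))

/-- The projection `E → Ē`, `u ↦ ū`. -/
def mk : E →ₗ[A] QuotMod S := (delSpan d E).mkQ

theorem mk_surjective : Function.Surjective (mk S) := Submodule.mkQ_surjective _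

theorem mk_eq {u v : E} (h : u - v ∈ delSpan d E) : mk S u = mk S v :=
  (Submodule.Quotient.eq _).2 h

theorem mk_sub_mem {u v : E} (h : mk S u = mk S v) : u - v ∈ delSpan d E :=
  (Submodule.Quotient.eq _).1 h

theorem mk_smul (c : 𝔽) (u : E) : mk S (c • u) = c • mk S u := rfl

theorem isTorsionBySet :
    Module.IsTorsionBySet A (QuotMod S) (Ideal.span (Set.range d) : Ideal A) := by
  rw [← Module.isTorsionBySet_iff_is_torsion_by_span]
  rintro x ⟨_, a, rfl⟩
  obtain ⟨u, rfl⟩ := mk_surjective S x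
  have h : ∀ b : A, b • u = (DiffOp.ofFun b : DiffOp d) • u := fun b => by
    rw [← one_smul (DiffOp d) u, ← smul_assoc, ← DiffOp.ofFun_mul, mul_one, one_smul]
  have key : d a • u = DiffOp.del d • (a • u) - a • (DiffOp.del d • u) := by
    rw [h, h a, ← smul_assoc a (DiffOp.del d) u, ← DiffOp.ofFun_mul, ← mul_smul,
      DiffOp.del_mul_ofFun, add_smul, add_sub_cancel_left]
  change d a • mk S u = 0
  rw [← map_smul, key]
  refine (mk_eq S (v := 0) ?_).trans (map_zero _)
  rw [sub_zero]
  exact Submodule.sub_mem _ (LieConformalAlgebroid.del_mem _)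
    (Submodule.smul_mem _ _ (LieConformalAlgebroid.del_mem _))

/-- The action of `Ā = A / A∂A` on `Ē`. -/
instance : Module (QuotAlg d) (QuotMod S) := (isTorsionBySet S).module

instance : IsScalarTower 𝔽 (QuotAlg d) (QuotMod S) :=
  Module.IsTorsionBySet.isScalarTower (isTorsionBySet S)

theorem mk_smul_mk (a : A) (u : E) : (Ideal.Quotient.mk _ a : QuotAlg d) • mk S u = mk S (a • u) :=
  rfl

/-- The bracket `[ū, v̄]`, the class of `[u_λ v]|_{λ = 0}`. -/
instance : Bracket (QuotMod S) (QuotMod S) where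
  bracket x y := Quotient.liftOn₂' x y (fun u v => mk S (S.bracket u v 0)) (by
    intro u v u' v' hu hv
    rw [← Quotient.eq''] at hu hv
    have hu := mk_sub_mem S hu
    have hv := mk_sub_mem S hv
    refine mk_eq S ?_
    have : S.bracket u v 0 - S.bracket u' v' 0 =
        S.bracket (u - u') v 0 + S.bracket u' (v - v') 0 := by
      simp only [map_sub, LinearMap.sub_apply, Finsupp.sub_apply]; abel
    rw [this]
    exact Submodule.add_mem _ (S.bracket_mem_left _ hu) (S.bracket_mem_right _ hv))

theorem bracket_mk (u v : E) : ⁅mk S u, mk S v⁆ = mk S (S.bracket u v 0) := rfl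

/-- The action of `Ē` on `Ā` through the anchor map `θ̄`; `θ̄(ū)(ā)` is the class of
`θ(u)_λ(a)|_{λ = 0}`. -/
instance : Bracket (QuotMod S) (QuotAlg d) where
  bracket x y := Quotient.liftOn₂' x y
    (fun u a => (Ideal.Quotient.mk _ ((S.anchor u).1 a 0) : QuotAlg d)) (by
    intro u a u' a' hu ha
    rw [← Quotient.eq''] at hu ha
    have hu := mk_sub_mem S hu
    have ha : a - a' ∈ Ideal.span (Set.range d) := Ideal.Quotient.eq.1 ha
    refine Ideal.Quotient.eq.2 ?_
    have : (S.anchor u).1 a 0 - (S.anchor u').1 a' 0 =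
        (S.anchor (u - u')).1 a 0 + (S.anchor u').1 (a - a') 0 := by
      rw [map_sub S.anchor, map_sub (S.anchor u').1, Submodule.coe_sub, LinearMap.sub_apply,
        Finsupp.sub_apply, Finsupp.sub_apply, sub_add_sub_cancel]
    rw [this]
    exact Ideal.add_mem _ (S.anchor_mem_left _ hu) (S.anchor_mem_right _ ha))

theorem bracket_mk_alg (u : E) (a : A) :
    ⁅mk S u, (Ideal.Quotient.mk _ a : QuotAlg d)⁆ = Ideal.Quotient.mk _ ((S.anchor u).1 a 0) := rfl

instance [CharZero 𝔽] : LieRing (QuotMod S) where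
  add_lie x y z := by
    obtain ⟨x, rfl⟩ := mk_surjective S x
    obtain ⟨y, rfl⟩ := mk_surjective S y
    obtain ⟨z, rfl⟩ := mk_surjective S z
    rw [← map_add, bracket_mk, bracket_mk, bracket_mk, ← map_add, map_add, LinearMap.add_apply,
      Finsupp.add_apply]
  lie_add x y z := by
    obtain ⟨x, rfl⟩ := mk_surjective S x
    obtain ⟨y, rfl⟩ := mk_surjective S y
    obtain ⟨z, rfl⟩ := mk_surjective S z
    rw [← map_add, bracket_mk, bracket_mk, bracket_mk, ← map_add, map_add, Finsupp.add_apply]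
  lie_self x := by
    obtain ⟨x, rfl⟩ := mk_surjective S x
    have h : mk S (S.bracket x x 0 + S.bracket x x 0) = 0 :=
      (mk_eq S (v := 0) (by rw [sub_zero]; exact S.bracket_add_mem x x)).trans (map_zero _)
    rw [← two_smul 𝔽, mk_smul, smul_eq_zero] at h
    exact h.resolve_left two_ne_zero
  leibniz_lie x y z := by
    obtain ⟨x, rfl⟩ := mk_surjective S x
    obtain ⟨y, rfl⟩ := mk_surjective S y
    obtain ⟨z, rfl⟩ := mk_surjective S z
    rw [bracket_mk, bracket_mk, bracket_mk, bracket_mk, bracket_mk, bracket_mk, ← map_add,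
      ← S.jacobi_zero]

instance [CharZero 𝔽] : LieAlgebra 𝔽 (QuotMod S) where
  lie_smul c x y := by
    obtain ⟨x, rfl⟩ := mk_surjective S x
    obtain ⟨y, rfl⟩ := mk_surjective S y
    rw [← mk_smul, bracket_mk, bracket_mk, ← mk_smul, map_smul, Finsupp.smul_apply]

instance [CharZero 𝔽] : LieRingModule (QuotMod S) (QuotAlg d) where
  add_lie x y a := by
    obtain ⟨x, rfl⟩ := mk_surjective S x
    obtain ⟨y, rfl⟩ := mk_surjective S y
    obtain ⟨a, rfl⟩ := Ideal.Quotient.mk_surjective a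
    rw [← map_add, bracket_mk_alg, bracket_mk_alg, bracket_mk_alg, ← map_add, map_add,
      Submodule.coe_add, LinearMap.add_apply, Finsupp.add_apply]
  lie_add x a b := by
    obtain ⟨x, rfl⟩ := mk_surjective S x
    obtain ⟨a, rfl⟩ := Ideal.Quotient.mk_surjective a
    obtain ⟨b, rfl⟩ := Ideal.Quotient.mk_surjective b
    rw [← map_add, bracket_mk_alg, bracket_mk_alg, bracket_mk_alg, ← map_add, map_add,
      Finsupp.add_apply]
  leibniz_lie x y a := by
    obtain ⟨x, rfl⟩ := mk_surjective S x
    obtain ⟨y, rfl⟩ := mk_surjective S y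
    obtain ⟨a, rfl⟩ := Ideal.Quotient.mk_surjective a
    rw [bracket_mk_alg, bracket_mk, bracket_mk_alg, bracket_mk_alg, bracket_mk_alg, bracket_mk_alg,
      ← map_add, S.anchor_bracket_zero, sub_add_cancel]

instance [CharZero 𝔽] : LieRinehartRing (QuotAlg d) (QuotMod S) where
  lie_smul_eq_mul' a b x := by
    obtain ⟨x, rfl⟩ := mk_surjective S x
    obtain ⟨a, rfl⟩ := Ideal.Quotient.mk_surjective a
    obtain ⟨b, rfl⟩ := Ideal.Quotient.mk_surjective b
    rw [mk_smul_mk, bracket_mk_alg, bracket_mk_alg, ← map_mul]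
    exact Ideal.Quotient.eq.2 (S.anchor_smul_mem a x b)
  leibniz_mul_right' x a b := by
    obtain ⟨x, rfl⟩ := mk_surjective S x
    obtain ⟨a, rfl⟩ := Ideal.Quotient.mk_surjective a
    obtain ⟨b, rfl⟩ := Ideal.Quotient.mk_surjective b
    rw [← map_mul, bracket_mk_alg, bracket_mk_alg, bracket_mk_alg, smul_eq_mul, ← map_mul,
      ← map_mul, ← map_add, (S.anchor x).2.2, Finsupp.add_apply, Finsupp.smul_apply,
      Finsupp.smul_apply, smul_eq_mul, smul_eq_mul, add_comm, mul_comm b]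
  leibniz_smul_right' x y a := by
    obtain ⟨x, rfl⟩ := mk_surjective S x
    obtain ⟨y, rfl⟩ := mk_surjective S y
    obtain ⟨a, rfl⟩ := Ideal.Quotient.mk_surjective a
    rw [mk_smul_mk, bracket_mk, bracket_mk, bracket_mk_alg, mk_smul_mk, mk_smul_mk, ← map_add,
      S.leibniz, Finsupp.add_apply, add_comm]
    rfl

/-- The quotient Lie algebroid `Ē` of a Lie conformal algebroid, over the algebra `Ā`. -/
instance [CharZero 𝔽] : LieRinehartAlgebra 𝔽 (QuotAlg d) (QuotMod S) where
  smul_lie c x a := by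
    obtain ⟨x, rfl⟩ := mk_surjective S x
    obtain ⟨a, rfl⟩ := Ideal.Quotient.mk_surjective a
    rw [← algebraMap_smul (QuotAlg d) c (mk S x), LieRinehartRing.lie_smul_eq_mul,
      Algebra.smul_def]
  lie_smul c x a := by
    obtain ⟨x, rfl⟩ := mk_surjective S x
    obtain ⟨a, rfl⟩ := Ideal.Quotient.mk_surjective a
    change ⁅mk S x, (Ideal.Quotient.mk _ (c • a) : QuotAlg d)⁆ =
      (Ideal.Quotient.mk _ (c • ((S.anchor x).1 a 0)) : QuotAlg d)
    rw [bracket_mk_alg, map_smul, Finsupp.smul_apply]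

end QuotMod

end Quotient

/-- `S` is a Lie conformal algebroid structure on `J_∞ R[∂] ⊗_R F` whose bracket extends the one of
the Lie algebroid `F`, `[1 ⊗ u _λ 1 ⊗ v] = 1 ⊗ [u, v]`, and whose anchor map at `1 ⊗ u` is the
conformal lift of `θ(u)`. -/
def IsCurrent {𝔽 R F : Type*} [Field 𝔽] [CommRing R] [Algebra 𝔽 R] [LieRing F] [LieAlgebra 𝔽 F]
    [Module R F] [LieRingModule F R] [LieRinehartRing R F] [LieRinehartAlgebra 𝔽 R F]
    (S : LieConformalAlgebroid (Jet.deriv 𝔽 R) (CurrentModule 𝔽 R F)) : Prop :=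
  (∀ u v : F, S.bracket (1 ⊗ₜ u) (1 ⊗ₜ v) = LPoly.const (1 ⊗ₜ ⁅u, v⁆)) ∧
    ∀ u : F, Jet.IsConformalLift (LieRinehartAlgebra.anchor 𝔽 R F u) (S.anchor (1 ⊗ₜ u))

end

/-! Everything rests on two generation facts: `ι(R)` generates `J_∞ R` as a differential algebra
(`Jet.induction`), and `1 ⊗ F` generates the current module over `J_∞ R[∂]`
(`CurrentModule.induction`). They give uniqueness of lifts, anchor and bracket; existence is the
real work.

A conformal lift is prescribed on differential polynomials and descends because it commutes with `∂`
up to `λ` and, on order-zero polynomials, is computed by `D` (`preLift_mem`). Its uniqueness makes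
`u ↦` lift of `θ(u)` additive and `R`-linear, so the anchor exists on the tensor product.

For the bracket, fix the left argument `x` with anchor `φ`. The operator `L = [x_λ ·]` must satisfy
`L(∂y) = (∂ + λ)L(y)` and `L(ay) = φ_λ(a)y + aL(y)`, which is `IsAdjoint`. This says that `y ↦ (y, L
y)` is linear over `J_∞ R[∂]` for a twisted action on `E × E[λ]`, so by the universal property of
the tensor product `L` may be prescribed on `1 ⊗ F`, subject only to additivity and the Leibniz rule
over `R` (`exists_isAdjoint`). This is used twice: for `x = 1 ⊗ u` with values `1 ⊗ [u, v]`, which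
gives `ad`, and then for arbitrary `x` with the values on `1 ⊗ v` that skew-symmetry dictates.
Uniqueness of such operators gives linearity and sesquilinearity on the left, and skew-symmetry
follows by generation.

The two remaining axioms are checked with the formal variables specialized to scalars, which loses
nothing over an infinite field. Each holds on generators, extends in its last argument, and is
carried to the other arguments by skew-symmetry (`AnchorBracket.swap`, `jacobi_rotate`).

For the quotient, sending all derivatives to zero gives retractions `J_∞ R → R` and `J_∞ R[∂] ⊗ F →
F`. They kill what is divided out and are inverse to the canonical maps on the quotients. -/

noncomputable section

/-! ### Polynomials in a formal variable: substitution, evaluation, translation, reflection. -/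

namespace LPoly

section Linear

variable {𝔽 : Type*} [Field 𝔽] {E V W : Type*} [AddCommGroup E] [Module 𝔽 E]
  [AddCommGroup V] [Module 𝔽 V] [AddCommGroup W] [Module 𝔽 W]

variable (𝔽 E) in
/-- The constants, as a linear map `E → E[λ]`. -/
def constL : E →ₗ[𝔽] LPoly E := Finsupp.lsingle 0

theorem const_add (e e' : E) : const (e + e') = const e + const e' := Finsupp.single_add _ _ _

theorem const_neg (e : E) : const (-e) = -const e := Finsupp.single_neg _ _

theorem const_smul {S : Type*} [Monoid S] [DistribMulAction S E] (c : S) (e : E) :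
    const (c • e) = c • const e := (Finsupp.smul_single _ _ _).symm

variable (𝔽) in
theorem map_const (f : E →ₗ[𝔽] V) (e : E) : map 𝔽 f (const e) = const (f e) := map_single 𝔽 f 0 e

variable (𝔽) in
theorem map_mulVar (f : E →ₗ[𝔽] V) (p : LPoly E) :
    map 𝔽 f (mulVar 𝔽 p) = mulVar 𝔽 (map 𝔽 f p) := by
  induction p using Finsupp.induction_linear with
  | zero => simp
  | add p q hp hq => simp only [map_add, hp, hq]
  | single n e => simp [mulVar_single, map_single]

variable (𝔽 E) in
@[elab_as_elim]
theorem induction {P : LPoly E → Prop} (p : LPoly E) (const : ∀ e, P (const e))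
    (add : ∀ p q, P p → P q → P (p + q)) (mulVar : ∀ p, P p → P (mulVar 𝔽 p)) : P p := by
  induction p using Finsupp.induction_linear with
  | zero => simpa [LPoly.const] using const 0
  | add p q hp hq => exact add p q hp hq
  | single n e =>
    induction n with
    | zero => exact const e
    | succ n ih => rw [← mulVar_single 𝔽]; exact mulVar _ ih

/-- Substitution for the formal variable, as a linear map. -/
def substL (S : Module.End 𝔽 V) (j : E →ₗ[𝔽] V) : LPoly E →ₗ[𝔽] V :=
  Finsupp.lsum 𝔽 fun n => (S ^ n) ∘ₗ j

theorem substL_apply (S : Module.End 𝔽 V) (j : E →ₗ[𝔽] V) (p : LPoly E) :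
    substL S j p = subst S j p := rfl

theorem substL_const (S : Module.End 𝔽 V) (j : E →ₗ[𝔽] V) (e : E) :
    substL S j (const e) = j e := by
  simp [substL, const]

theorem substL_mulVar (S : Module.End 𝔽 V) (j : E →ₗ[𝔽] V) (p : LPoly E) :
    substL S j (mulVar 𝔽 p) = S (substL S j p) := by
  induction p using Finsupp.induction_linear with
  | zero => simp
  | add p q hp hq => simp only [map_add, hp, hq]
  | single n e => simp [mulVar_single, substL, pow_succ']

theorem substL_map (S : Module.End 𝔽 V) (j : W →ₗ[𝔽] V) (f : E →ₗ[𝔽] W) (p : LPoly E) :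
    substL S j (map 𝔽 f p) = substL S (j ∘ₗ f) p := by
  induction p using LPoly.induction 𝔽 E with
  | const e => rw [map_const, substL_const, substL_const]; rfl
  | add p q hp hq => simp only [map_add, hp, hq]
  | mulVar p hp => rw [map_mulVar, substL_mulVar, substL_mulVar, hp]

theorem apply_substL (f : V →ₗ[𝔽] W) {S : Module.End 𝔽 V} {S' : Module.End 𝔽 W}
    (h : ∀ x, f (S x) = S' (f x)) (j : E →ₗ[𝔽] V) (p : LPoly E) :
    f (substL S j p) = substL S' (f ∘ₗ j) p := by
  induction p using LPoly.induction 𝔽 E with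
  | const e => rw [substL_const, substL_const]; rfl
  | add p q hp hq => simp only [map_add, hp, hq]
  | mulVar p hp => rw [substL_mulVar, substL_mulVar, h, hp]

/-- The value of a polynomial at an operator. -/
def evalEnd (S : Module.End 𝔽 E) : LPoly E →ₗ[𝔽] E := substL S LinearMap.id

/-- The value of a polynomial at a scalar. -/
def eval (c : 𝔽) : LPoly E →ₗ[𝔽] E := evalEnd (c • 1)

theorem evalEnd_const (S : Module.End 𝔽 E) (e : E) : evalEnd S (const e) = e := substL_const _ _ _

theorem evalEnd_mulVar (S : Module.End 𝔽 E) (p : LPoly E) :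
    evalEnd S (mulVar 𝔽 p) = S (evalEnd S p) := substL_mulVar _ _ _

theorem eval_const (c : 𝔽) (e : E) : eval c (const e) = e := substL_const _ _ _

theorem eval_mulVar (c : 𝔽) (p : LPoly E) : eval c (mulVar 𝔽 p) = c • eval c p :=
  substL_mulVar _ _ _

theorem eval_map (c : 𝔽) (f : E →ₗ[𝔽] V) (p : LPoly E) : eval c (map 𝔽 f p) = f (eval c p) :=
  (substL_map _ _ _ _).trans
    (apply_substL f (S := c • 1) (S' := c • 1) (by simp) LinearMap.id p).symm

theorem eval_substL {S : Module.End 𝔽 (LPoly V)} {S' : Module.End 𝔽 V} (c : 𝔽)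
    (h : ∀ x, eval c (S x) = S' (eval c x)) (j : E →ₗ[𝔽] LPoly V) (p : LPoly E) :
    eval c (substL S j p) = substL S' (eval c ∘ₗ j) p := apply_substL _ h _ _

/-- Linear functionals separate the points of `E`, which reduces each coefficient to a polynomial
over `𝔽`, where vanishing at infinitely many scalars suffices. -/
theorem ext_eval [Infinite 𝔽] {p q : LPoly E} (h : ∀ c : 𝔽, eval c p = eval c q) : p = q := by
  rw [← sub_eq_zero]
  have h : ∀ c : 𝔽, eval c (p - q) = 0 := fun c => by rw [map_sub, h, sub_self]
  generalize p - q = p at h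
  ext n
  refine (Module.forall_dual_apply_eq_zero_iff 𝔽 _).1 fun f => ?_
  let P : LPoly 𝔽 →ₗ[𝔽] Polynomial 𝔽 := Finsupp.lsum 𝔽 Polynomial.monomial
  have hP : ∀ (c : 𝔽) (r : LPoly 𝔽), (P r).eval c = eval c r := by
    intro c r
    induction r using Finsupp.induction_linear with
    | zero => simp
    | add r s hr hs => simp only [map_add, Polynomial.eval_add, hr, hs]
    | single n e => simp [P, eval, evalEnd, substL, smul_pow, mul_comm]
  have hP' : ∀ (r : LPoly 𝔽) (n : ℕ), (P r).coeff n = r n := by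
    intro r n
    induction r using Finsupp.induction_linear with
    | zero => simp
    | add r s hr hs => simp only [map_add, Polynomial.coeff_add, hr, hs, Finsupp.add_apply]
    | single m e => simp [P, Polynomial.coeff_monomial, Finsupp.single_apply]
  have h0 : P (map 𝔽 f p) = 0 := Polynomial.funext fun c => by
    rw [hP, eval_map, h, map_zero, Polynomial.eval_zero]
  rw [← map_apply 𝔽, ← hP', h0, Polynomial.coeff_zero]

/-- The value of a polynomial in two variables `λ`, `μ` at a pair of scalars. -/
def eval₂ (a b : 𝔽) : LPoly (LPoly E) →ₗ[𝔽] E := eval a ∘ₗ eval b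

theorem eval₂_var₁ (a b : 𝔽) (x : LPoly (LPoly E)) :
    eval₂ a b (var₁ 𝔽 x) = a • eval₂ a b x := by
  rw [eval₂, LinearMap.comp_apply, var₁, eval_map, eval_mulVar]; rfl

theorem eval₂_var₂ (a b : 𝔽) (x : LPoly (LPoly E)) :
    eval₂ a b (var₂ 𝔽 x) = b • eval₂ a b x := by
  rw [eval₂, LinearMap.comp_apply, var₂, eval_mulVar, map_smul]; rfl

theorem eval₂_const₂ (a b : 𝔽) (e : E) : eval₂ a b (const₂ e) = e := by
  rw [eval₂, LinearMap.comp_apply, const₂, eval_const, eval_const]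

theorem ext_eval₂ [Infinite 𝔽] {p q : LPoly (LPoly E)}
    (h : ∀ a b : 𝔽, eval₂ a b p = eval₂ a b q) : p = q :=
  ext_eval fun b => ext_eval fun a => h a b

/-- Turns the nested formal substitutions of the Jacobi and anchor axioms into evaluations at
scalars. The map `j` need not be linear, since the axioms substitute through bare functions; only
its evaluated form `f` is. -/
theorem eval₂_subst {S : Module.End 𝔽 (LPoly (LPoly V))} {a b c : 𝔽}
    (h : ∀ x, eval₂ a b (S x) = c • eval₂ a b x) (j : E → LPoly (LPoly V)) (f : E →ₗ[𝔽] V)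
    (hf : ∀ e, eval₂ a b (j e) = f e) (p : LPoly E) :
    eval₂ a b (subst S j p) = f (eval c p) := by
  rw [← eval_map]
  have hn : ∀ (n : ℕ) (x), eval₂ a b ((S ^ n) x) = c ^ n • eval₂ a b x := by
    intro n x
    induction n with
    | zero => simp
    | succ n ih => rw [pow_succ', Module.End.mul_apply, h, ih, pow_succ', mul_smul]
  rw [eval, evalEnd, substL_map, substL_apply, subst, subst, Finsupp.sum, Finsupp.sum, map_sum]
  refine Finset.sum_congr rfl fun n _ => ?_
  rw [hn, hf, smul_pow, one_pow]; rfl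

/-- The translation `p(λ) ↦ p(λ + c)`. -/
def translate (c : 𝔽) : LPoly E →ₗ[𝔽] LPoly E := substL (mulVar 𝔽 + c • 1) (constL 𝔽 E)

theorem translate_const (c : 𝔽) (e : E) : translate c (const e) = const e := substL_const _ _ _

theorem translate_mulVar (c : 𝔽) (p : LPoly E) :
    translate c (mulVar 𝔽 p) = mulVar 𝔽 (translate c p) + c • translate c p := substL_mulVar _ _ _

theorem evalEnd_translate (c : 𝔽) (S : Module.End 𝔽 E) (p : LPoly E) :
    evalEnd S (translate c p) = evalEnd (S + c • 1) p := by
  have h : ∀ x, evalEnd S ((mulVar 𝔽 + c • 1 : Module.End 𝔽 (LPoly E)) x) =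
      (S + c • 1) (evalEnd S x) := fun x => by
    simp [evalEnd_mulVar]
  refine (apply_substL _ h _ _).trans ?_
  rw [evalEnd]; congr 2
  ext e; exact evalEnd_const S e

theorem eval_translate (a c : 𝔽) (p : LPoly E) : eval a (translate c p) = eval (a + c) p := by
  rw [eval, evalEnd_translate, ← add_smul]; rfl

theorem map_translate (c : 𝔽) (f : E →ₗ[𝔽] V) (p : LPoly E) :
    map 𝔽 f (translate c p) = translate c (map 𝔽 f p) := by
  induction p using LPoly.induction 𝔽 E with
  | const e => rw [translate_const, map_const, translate_const]
  | add p q hp hq => simp only [map_add, hp, hq]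
  | mulVar p hp =>
    rw [translate_mulVar, map_add, map_mulVar, map_mulVar, translate_mulVar, map_smul, hp]

/-- The substitution `p(λ) ↦ p(-λ - T)` with `T` acting on everything to its right. -/
def reflect (T : Module.End 𝔽 E) : LPoly E →ₗ[𝔽] LPoly E :=
  substL (-mulVar 𝔽 - map 𝔽 T) (constL 𝔽 E)

variable (T : Module.End 𝔽 E)

theorem reflect_const (e : E) : reflect T (const e) = const e := substL_const _ _ _

theorem reflect_mulVar (p : LPoly E) :
    reflect T (mulVar 𝔽 p) = -mulVar 𝔽 (reflect T p) - map 𝔽 T (reflect T p) := substL_mulVar _ _ _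

theorem reflect_map (p : LPoly E) : reflect T (map 𝔽 T p) = map 𝔽 T (reflect T p) := by
  induction p using LPoly.induction 𝔽 E with
  | const e => simp only [map_const, reflect_const]
  | add p q hp hq => simp only [map_add, hp, hq]
  | mulVar p hp => rw [map_mulVar, reflect_mulVar, hp, reflect_mulVar, map_sub, map_neg, map_mulVar]

/-- Reflection exchanges the operators `∂ + λ` and `-λ`, hence the right and left sesquilinearity
rules. -/
theorem reflect_map_add_mulVar (p : LPoly E) :
    reflect T (map 𝔽 T p + mulVar 𝔽 p) = -mulVar 𝔽 (reflect T p) := by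
  rw [map_add, reflect_map, reflect_mulVar]; abel

theorem reflect_neg_mulVar (p : LPoly E) :
    reflect T (-mulVar 𝔽 p) = map 𝔽 T (reflect T p) + mulVar 𝔽 (reflect T p) := by
  rw [map_neg, reflect_mulVar]; abel

/-- Since `λ` and `∂` commute, `λ ↦ -λ - ∂` is an involution, so skew-symmetry for `(u, v)` and for
`(v, u)` are the same condition. -/
theorem reflect_reflect (p : LPoly E) : reflect T (reflect T p) = p := by
  induction p using LPoly.induction 𝔽 E with
  | const e => simp only [reflect_const]
  | add p q hp hq => simp only [map_add, hp, hq]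
  | mulVar p hp => rw [reflect_mulVar, map_sub, reflect_neg_mulVar, reflect_map, hp]; abel

theorem eval_reflect (c : 𝔽) (p : LPoly E) :
    eval c (reflect T p) = evalEnd (-(c • 1) - T) p := by
  have h : ∀ x, eval c ((-mulVar 𝔽 - map 𝔽 T : Module.End 𝔽 (LPoly E)) x) =
      (-(c • 1) - T) (eval c x) := fun x => by
    simp [eval_mulVar, eval_map]
  refine (eval_substL c h _ _).trans ?_
  rw [evalEnd]; congr 2
  ext e; exact eval_const c e

end Linear

/-! ### Polynomials with coefficients in an algebra, acting on a module with a compatible `∂`. -/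

section Module

variable {𝔽 A : Type*} [Field 𝔽] [CommRing A] [Algebra 𝔽 A]
  {E : Type*} [AddCommGroup E] [Module 𝔽 E] [Module A E] [IsScalarTower 𝔽 A E]

theorem mulVar_smul' (a : A) (p : LPoly E) : mulVar 𝔽 (a • p) = a • mulVar 𝔽 p := by
  induction p using Finsupp.induction_linear with
  | zero => simp
  | add p q hp hq => simp only [smul_add, map_add, hp, hq]
  | single n b => rw [Finsupp.smul_single, mulVar_single, mulVar_single, Finsupp.smul_single]

variable (𝔽) in
/-- The product `A[λ] × E → E[λ]`. -/
def mulVec (p : LPoly A) (v : E) : LPoly E :=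
  map 𝔽 ((LinearMap.toSpanSingleton A E v).restrictScalars 𝔽) p

theorem mulVec_const (a : A) (v : E) : mulVec 𝔽 (const a) v = const (a • v) := map_const 𝔽 _ a

theorem mulVec_mulVar (p : LPoly A) (v : E) :
    mulVec 𝔽 (mulVar 𝔽 p) v = mulVar 𝔽 (mulVec 𝔽 p v) := map_mulVar 𝔽 _ _

theorem mulVec_add (p : LPoly A) (v w : E) :
    mulVec 𝔽 p (v + w) = mulVec 𝔽 p v + mulVec 𝔽 p w := by
  ext n; exact smul_add _ _ _

theorem add_mulVec (p q : LPoly A) (v : E) :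
    mulVec 𝔽 (p + q) v = mulVec 𝔽 p v + mulVec 𝔽 q v := map_add _ _ _

theorem neg_mulVec (p : LPoly A) (v : E) : mulVec 𝔽 (-p) v = -mulVec 𝔽 p v := map_neg _ _

theorem smul_mulVec (c : 𝔽) (p : LPoly A) (v : E) :
    mulVec 𝔽 (c • p) v = c • mulVec 𝔽 p v := map_smul _ _ _

theorem zero_mulVec (v : E) : mulVec 𝔽 (0 : LPoly A) v = 0 := map_zero _

theorem mulVec_zero (p : LPoly A) : mulVec 𝔽 p (0 : E) = 0 := by
  ext n; exact smul_zero _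

theorem mulVec_smul (p : LPoly A) (a : A) (v : E) :
    mulVec 𝔽 p (a • v) = a • mulVec 𝔽 p v := by
  ext n; exact smul_comm _ _ _

theorem smul_mulVec' (a : A) (p : LPoly A) (v : E) :
    mulVec 𝔽 (a • p) v = a • mulVec 𝔽 p v := by
  ext n; exact mul_smul _ _ _

theorem eval_mulVec (c : 𝔽) (p : LPoly A) (v : E) :
    eval c (mulVec 𝔽 p v) = eval c p • v := eval_map _ _ _

theorem eval_smul (c : 𝔽) (a : A) (p : LPoly E) : eval c (a • p) = a • eval c p := by
  induction p using LPoly.induction 𝔽 E with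
  | const e => rw [← const_smul, eval_const, eval_const]
  | add p q hp hq => simp only [smul_add, map_add, hp, hq]
  | mulVar p hp => rw [← mulVar_smul', eval_mulVar, hp, eval_mulVar, smul_comm]

variable {d : Derivation 𝔽 A A} (T : Module.End 𝔽 E)
  (hT : ∀ (a : A) (e : E), T (a • e) = d a • e + a • T e)

include hT in
theorem map_smul_leibniz (a : A) (p : LPoly E) :
    map 𝔽 T (a • p) = d a • p + a • map 𝔽 T p := by
  ext n; exact hT _ _

include hT in
theorem map_mulVec_leibniz (p : LPoly A) (v : E) :
    map 𝔽 T (mulVec 𝔽 p v) + mulVar 𝔽 (mulVec 𝔽 p v) =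
      mulVec 𝔽 (varAdd d p) v + mulVec 𝔽 p (T v) := by
  have : map 𝔽 T (mulVec 𝔽 p v) =
      mulVec 𝔽 (map 𝔽 (d : A →ₗ[𝔽] A) p) v + mulVec 𝔽 p (T v) := by
    ext n; exact hT _ _
  rw [this, varAdd, LinearMap.add_apply, add_mulVec, mulVec_mulVar]; abel

/-- The multiplication `∑ λⁿ eₙ ↦ ∑ ((λ + ∂)ⁿ a) eₙ` by `a` shifted by the formal variable. -/
def shiftSMul (a : A) (p : LPoly E) : LPoly E := reflect T (a • reflect T p)

theorem reflect_shiftSMul (a : A) (p : LPoly E) :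
    reflect T (shiftSMul T a p) = a • reflect T p := reflect_reflect _ _

theorem reflect_smul (a : A) (p : LPoly E) :
    reflect T (a • p) = shiftSMul T a (reflect T p) := by
  rw [shiftSMul, reflect_reflect]

theorem shiftSMul_add (a : A) (p q : LPoly E) :
    shiftSMul T a (p + q) = shiftSMul T a p + shiftSMul T a q := by
  simp only [shiftSMul, map_add, smul_add]

theorem shiftSMul_neg (a : A) (p : LPoly E) :
    shiftSMul T a (-p) = -shiftSMul T a p := by
  simp only [shiftSMul, map_neg, smul_neg]

theorem shiftSMul_const (a : A) (e : E) : shiftSMul T a (const e) = const (a • e) := by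
  rw [shiftSMul, reflect_const, ← const_smul, reflect_const]

theorem shiftSMul_map_add_mulVar (a : A) (p : LPoly E) :
    shiftSMul T a (map 𝔽 T p + mulVar 𝔽 p) =
      map 𝔽 T (shiftSMul T a p) + mulVar 𝔽 (shiftSMul T a p) := by
  rw [shiftSMul, reflect_map_add_mulVar, smul_neg, ← mulVar_smul', reflect_neg_mulVar]; rfl

include hT in
-- After one reflection this is the Leibniz rule of `T`. It is the recursion `(λ + ∂)ⁿ⁺¹ a = (λ +
-- ∂)ⁿ(λa + ∂a)` behind all inductions on the degree.
theorem shiftSMul_mulVar (a : A) (p : LPoly E) :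
    shiftSMul T a (mulVar 𝔽 p) = mulVar 𝔽 (shiftSMul T a p) + shiftSMul T (d a) p := by
  have : a • reflect T (mulVar 𝔽 p) =
      -(map 𝔽 T (a • reflect T p) + mulVar 𝔽 (a • reflect T p)) + d a • reflect T p := by
    rw [reflect_mulVar, map_smul_leibniz T hT, mulVar_smul', smul_sub, smul_neg]; abel
  rw [shiftSMul, this, map_add, map_neg, reflect_map_add_mulVar, neg_neg]; rfl

include hT in
theorem shiftSMul_smul (a b : A) (p : LPoly E) :
    shiftSMul T a (b • p) = b • shiftSMul T a p := by
  -- The degree step replaces `a` by `d a`, so `a` has to vary.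
  induction p using LPoly.induction 𝔽 E generalizing a with
  | const e => rw [← const_smul, shiftSMul_const, shiftSMul_const, smul_comm, const_smul]
  | add p q hp hq => simp only [smul_add, shiftSMul_add, hp, hq]
  | mulVar p hp =>
    rw [← mulVar_smul', shiftSMul_mulVar T hT, hp, hp, shiftSMul_mulVar T hT, smul_add,
      mulVar_smul']

include hT in
-- Both sides obey the same recursion in the degree of `p`. This matches the action of `A` on
-- conformal derivations with the shifted action on `E[λ]`.
theorem shiftMul_mulVec (a : A) (p : LPoly A) (v : E) :
    mulVec 𝔽 (shiftMul d a p) v = shiftSMul T a (mulVec 𝔽 p v) := by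
  induction p using LPoly.induction 𝔽 A generalizing a with
  | const c =>
    rw [mulVec_const, shiftSMul_const, const, shiftMul_single, pow_zero, Module.End.one_apply,
      ← const_smul, mulVec_const, smul_eq_mul, mul_comm, mul_smul]
  | add p q hp hq => simp only [map_add, add_mulVec, shiftSMul_add, hp, hq]
  | mulVar p hp =>
    rw [shiftMul_mulVar, add_mulVec, mulVec_mulVar, hp, hp, mulVec_mulVar, shiftSMul_mulVar T hT]

end Module

/-! ### Translation against shifted multiplication. -/

section Shift

variable {𝔽 A : Type*} [Field 𝔽] [CommRing A] [Algebra 𝔽 A] (d : Derivation 𝔽 A A)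

theorem shiftMul_const (a c : A) : shiftMul d a (const c) = const (a * c) := by
  rw [const, shiftMul_single, pow_zero, Module.End.one_apply, ← const_smul, smul_eq_mul, mul_comm]

theorem shiftMul_smul (a : A) (c : 𝔽) (p : LPoly A) :
    shiftMul d a (c • p) = c • shiftMul d a p :=
  ((shiftMul d a).restrictScalars 𝔽).map_smul c p

theorem translate_shiftMul (c : 𝔽) (a : A) (p : LPoly A) :
    translate c (shiftMul d a p) = shiftMul d a (translate c p) := by
  induction p using LPoly.induction 𝔽 A generalizing a with
  | const e => rw [shiftMul_const, translate_const, translate_const, shiftMul_const]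
  | add p q hp hq => simp only [map_add, hp, hq]
  | mulVar p hp =>
    rw [shiftMul_mulVar, map_add, translate_mulVar, hp, hp, translate_mulVar, map_add,
      shiftMul_mulVar, shiftMul_smul]
    abel

theorem translate_smul (c : 𝔽) (a : A) (p : LPoly A) :
    translate c (a • p) = a • translate c p := by
  induction p using LPoly.induction 𝔽 A with
  | const e => rw [← const_smul, translate_const, translate_const, const_smul]
  | add p q hp hq => simp only [smul_add, map_add, hp, hq]
  | mulVar p hp =>
    rw [← mulVar_smul', translate_mulVar, hp, translate_mulVar, smul_add, mulVar_smul',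
      smul_comm a c]

theorem translate_varAdd (c : 𝔽) (p : LPoly A) :
    translate c (varAdd d p) = varAdd d (translate c p) + c • translate c p := by
  rw [varAdd, LinearMap.add_apply, map_add, translate_mulVar, ← map_translate,
    LinearMap.add_apply]
  abel

theorem shiftMul_algebraMap (c : 𝔽) (p : LPoly A) : shiftMul d (algebraMap 𝔽 A c) p = c • p := by
  induction p using LPoly.induction 𝔽 A with
  | const e => rw [shiftMul_const, ← smul_eq_mul, algebraMap_smul, const_smul]
  | add p q hp hq => simp only [map_add, smul_add, hp, hq]
  | mulVar q hq =>
    rw [shiftMul_mulVar, hq, Derivation.map_algebraMap, shiftMul_zero, LinearMap.zero_apply,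
      add_zero, map_smul]

/-- A derivation `ψ` of `A` with `ψ(∂a) = (∂ + c) ψ(a)`, applied to a shifted product. -/
theorem map_shiftMul (c : 𝔽) (ψ : A →ₗ[𝔽] A) (h1 : ∀ a, ψ (d a) = d (ψ a) + c • ψ a)
    (h2 : ∀ a b, ψ (a * b) = b * ψ a + a * ψ b) (b : A) (p : LPoly A) :
    map 𝔽 ψ (shiftMul d b p) =
      shiftMul d b (map 𝔽 ψ p) + translate c (shiftMul d (ψ b) p) := by
  induction p using LPoly.induction 𝔽 A generalizing b with
  | const e =>
    rw [shiftMul_const, map_const, map_const, shiftMul_const, shiftMul_const, translate_const, h2,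
      ← const_add, add_comm, mul_comm e]
  | add p q hp hq => simp only [map_add, hp, hq]; abel
  | mulVar p hp =>
    have h3 : shiftMul d (c • ψ b) p = c • shiftMul d (ψ b) p := by
      rw [← algebraMap_smul A c (ψ b), smul_eq_mul, shiftMul_mul, shiftMul_algebraMap]
    rw [shiftMul_mulVar, map_add, map_mulVar, hp, hp, map_mulVar, shiftMul_mulVar, shiftMul_mulVar,
      h1, shiftMul_add, LinearMap.add_apply, h3]
    simp only [map_add, translate_mulVar, map_smul]
    abel

end Shift

end LPoly

/-! ### Conformal lifts of derivations to the jet algebra. -/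

namespace Jet

open LPoly MvPolynomial

variable {𝔽 R : Type*} [Field 𝔽] [CommRing R] [Algebra 𝔽 R]

/-- The jet algebra is generated by `R` as a differential algebra. -/
@[elab_as_elim]
theorem induction {P : Jet 𝔽 R → Prop} (a : Jet 𝔽 R) (ι : ∀ r, P (ι 𝔽 R r))
    (add : ∀ a b, P a → P b → P (a + b)) (mul : ∀ a b, P a → P b → P (a * b))
    (deriv : ∀ a, P a → P (deriv 𝔽 R a)) : P a := by
  obtain ⟨q, rfl⟩ := Ideal.Quotient.mk_surjective a
  induction q using MvPolynomial.induction_on with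
  | C c =>
    have h := ι (algebraMap 𝔽 R c)
    rwa [AlgHom.commutes] at h
  | add p q hp hq => rw [map_add]; exact add _ _ hp hq
  | mul_X p i hp =>
    rw [map_mul]
    refine mul _ _ hp ?_
    obtain ⟨r, n⟩ := i
    rw [← deriv_iterate_ι]
    induction n with
    | zero => exact ι r
    | succ n ih => rw [Function.iterate_succ_apply']; exact deriv _ ih

theorem conformalLift_unique {D : Derivation 𝔽 R R} {φ ψ : CDer (deriv 𝔽 R)}
    (hφ : IsConformalLift D φ) (hψ : IsConformalLift D ψ) : φ = ψ := by
  refine Subtype.ext (LinearMap.ext fun a => ?_)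
  induction a using Jet.induction with
  | ι r => rw [hφ, hψ]
  | add a b ha hb => rw [map_add, map_add, ha, hb]
  | mul a b ha hb => rw [φ.2.2, ψ.2.2, ha, hb]
  | deriv a ha => rw [φ.2.1, ψ.2.1, ha]

theorem mvPolynomial_smul (q : MvPolynomial (R × ℕ) 𝔽) (p : LPoly (Jet 𝔽 R)) :
    q • p = Ideal.Quotient.mk (ideal 𝔽 R) q • p := by
  ext n
  rw [Finsupp.smul_apply, Finsupp.smul_apply]
  obtain ⟨x, hx⟩ := Ideal.Quotient.mk_surjective (p n)
  rw [← hx]; rfl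

/-- The derivation of differential polynomials with values in `(J_∞ R)[λ]` that underlies the
conformal lift of `D`. -/
def preLift (D : Derivation 𝔽 R R) :
    Derivation 𝔽 (MvPolynomial (R × ℕ) 𝔽) (LPoly (Jet 𝔽 R)) :=
  mkDerivation 𝔽 fun p => (varAdd (deriv 𝔽 R) ^ p.2) (const (ι 𝔽 R (D p.1)))

theorem preLift_polyDeriv (D : Derivation 𝔽 R R) (q : MvPolynomial (R × ℕ) 𝔽) :
    preLift D (polyDeriv 𝔽 R q) = varAdd (deriv 𝔽 R) (preLift D q) := by
  induction q using MvPolynomial.induction_on with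
  | C c => simp only [derivation_C, map_zero]
  | add p q hp hq => simp only [map_add, hp, hq]
  | mul_X p i hp =>
    have : preLift D (polyDeriv 𝔽 R (X i)) = varAdd (deriv 𝔽 R) (preLift D (X i)) := by
      rw [polyDeriv, mkDerivation_X, preLift, mkDerivation_X, mkDerivation_X, pow_succ',
        Module.End.mul_apply]
    simp only [Derivation.leibniz, map_add, smul_eq_mul, hp, this, mvPolynomial_smul,
      varAdd_smul, deriv_mk]
    abel

/-- On polynomials of order zero, `preLift D` and `D` obey the same Leibniz rule and agree on
variables. Hence relations among elements of `R` are sent to `D(0) = 0`. -/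
theorem preLift_rename (D : Derivation 𝔽 R R) (p : MvPolynomial R 𝔽) :
    preLift D (rename (fun r => (r, 0)) p) = const (ι 𝔽 R (D (aeval (id : R → R) p))) := by
  have hmk : ∀ p : MvPolynomial R 𝔽, Ideal.Quotient.mk (ideal 𝔽 R) (rename (fun r => (r, 0)) p) =
      ι 𝔽 R (aeval (id : R → R) p) := fun p => by
    refine (mk_rename 𝔽 R (q := X (aeval (id : R → R) p)) (by simp)).trans ?_
    rw [rename_X]; rfl
  induction p using MvPolynomial.induction_on with
  | C c => simp [const, Derivation.map_algebraMap]
  | add p q hp hq => simp only [map_add, hp, hq, const_add]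
  | mul_X p r hp =>
    have h1 : rename (fun r : R => (r, 0)) (p * X r) =
        rename (fun r => (r, 0)) p * (rename (fun r => (r, 0)) (X r) : MvPolynomial (R × ℕ) 𝔽) :=
      map_mul _ _ _
    have h2 : preLift D (rename (fun r => (r, 0)) (X r)) = const (ι 𝔽 R (D r)) := by
      rw [rename_X, preLift, mkDerivation_X, pow_zero, Module.End.one_apply]
    rw [h1, Derivation.leibniz, h2, hp, mvPolynomial_smul, mvPolynomial_smul, hmk p, hmk (X r)]
    have h3 : ∀ a b : Jet 𝔽 R, a • const b = const (a * b) := fun a b => (const_smul a b).symm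
    rw [h3, h3, ← const_add, map_mul, Derivation.leibniz, aeval_X, id_eq, ← map_mul, ← map_mul,
      ← map_add]
    rfl

/-- Relations are killed by `preLift_rename` and their derivatives by `preLift_polyDeriv`. For a
multiple `a x` with `x` in the ideal, the extra Leibniz term vanishes because `x` acts as zero on
`(J_∞ R)[λ]`. -/
theorem preLift_mem (D : Derivation 𝔽 R R) {q : MvPolynomial (R × ℕ) 𝔽} (hq : q ∈ ideal 𝔽 R) :
    preLift D q = 0 := by
  refine Submodule.span_induction ?_ ?_ ?_ ?_ hq
  · rintro _ ⟨n, p, hp, rfl⟩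
    induction n with
    | zero =>
      rw [Function.iterate_zero_apply, preLift_rename, hp, map_zero, map_zero, const,
        Finsupp.single_zero]
    | succ n ih => rw [Function.iterate_succ_apply', preLift_polyDeriv, ih, map_zero]
  · exact map_zero _
  · intro x y _ _ hx hy
    rw [map_add, hx, hy, add_zero]
  · intro a x hx' hx
    rw [smul_eq_mul, Derivation.leibniz, hx, smul_zero, zero_add, mvPolynomial_smul,
      (Ideal.Quotient.eq_zero_iff_mem.2 hx' : Ideal.Quotient.mk (ideal 𝔽 R) x = 0)]
    exact zero_smul (Jet 𝔽 R) (preLift D a)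

theorem exists_conformalLift (D : Derivation 𝔽 R R) :
    ∃ φ : CDer (deriv 𝔽 R), IsConformalLift D φ := by
  let Φ : Jet 𝔽 R →ₗ[𝔽] LPoly (Jet 𝔽 R) :=
    ((ideal 𝔽 R).restrictScalars 𝔽).liftQ (preLift D : MvPolynomial (R × ℕ) 𝔽 →ₗ[𝔽] _)
      fun q hq => LinearMap.mem_ker.2 (preLift_mem D hq)
  have hΦ : ∀ q, Φ (Ideal.Quotient.mk _ q) = preLift D q := fun q => rfl
  refine ⟨⟨Φ, fun a => ?_, fun a b => ?_⟩, fun r => ?_⟩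
  · obtain ⟨q, rfl⟩ := Ideal.Quotient.mk_surjective a
    rw [deriv_mk, hΦ, hΦ, preLift_polyDeriv]
  · obtain ⟨p, rfl⟩ := Ideal.Quotient.mk_surjective a
    obtain ⟨q, rfl⟩ := Ideal.Quotient.mk_surjective b
    rw [← map_mul, hΦ, hΦ, hΦ, Derivation.leibniz, mvPolynomial_smul, mvPolynomial_smul, add_comm]
  · have : ι 𝔽 R r = Ideal.Quotient.mk _ (X (r, 0)) := rfl
    change Φ (ι 𝔽 R r) = _
    rw [this, hΦ, preLift, mkDerivation_X, pow_zero, Module.End.one_apply]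

/-- The conformal lift of a derivation. -/
def conformalLift (D : Derivation 𝔽 R R) : CDer (deriv 𝔽 R) := (exists_conformalLift D).choose

theorem isConformalLift (D : Derivation 𝔽 R R) : IsConformalLift D (conformalLift D) :=
  (exists_conformalLift D).choose_spec

theorem conformalLift_add (D D' : Derivation 𝔽 R R) :
    conformalLift (D + D') = conformalLift D + conformalLift D' := by
  refine conformalLift_unique (isConformalLift _) fun r => ?_
  rw [Submodule.coe_add, LinearMap.add_apply, isConformalLift, isConformalLift,
    Derivation.add_apply, map_add, const_add]

/-- Both sides are lifts of the same derivation. This compatibility lets the anchor descend to the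
tensor product over `R`. -/
theorem conformalLift_smul (s : R) (D : Derivation 𝔽 R R) :
    conformalLift (s • D) = (DiffOp.ofFun (ι 𝔽 R s) : DiffOp (deriv 𝔽 R)) • conformalLift D := by
  refine conformalLift_unique (isConformalLift _) fun r => ?_
  rw [CDer.ofFun_smul]
  change shiftMul _ _ ((conformalLift D).1 _) = _
  rw [isConformalLift, shiftMul_const, Derivation.smul_apply, smul_eq_mul, map_mul]

end Jet

/-! ### Conformal derivations evaluated at a scalar. -/

namespace CDer

open LPoly

variable {𝔽 A : Type*} [Field 𝔽] [CommRing A] [Algebra 𝔽 A] {d : Derivation 𝔽 A A}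

theorem map_algebraMap (φ : CDer d) (c : 𝔽) : φ.1 (algebraMap 𝔽 A c) = 0 := by
  have h : φ.1 1 = 0 := by
    have := φ.2.2 1 1
    rw [mul_one, one_smul] at this
    exact left_eq_add.1 this
  rw [Algebra.algebraMap_eq_smul_one, map_smul, h, smul_zero]

theorem ofFun_smul_apply (a : A) (φ : CDer d) (b : A) :
    ((DiffOp.ofFun a : DiffOp d) • φ).1 b = shiftMul d a (φ.1 b) := by
  rw [ofFun_smul]; rfl

theorem del_smul_apply (φ : CDer d) (b : A) :
    (DiffOp.del d • φ).1 b = -mulVar 𝔽 (φ.1 b) := by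
  rw [del_smul]; rfl

/-- The value `φ_c` of a conformal derivation at a scalar. -/
def evalAt (c : 𝔽) (φ : CDer d) : A →ₗ[𝔽] A := eval c ∘ₗ φ.1

theorem evalAt_deriv (c : 𝔽) (φ : CDer d) (a : A) :
    evalAt c φ (d a) = d (evalAt c φ a) + c • evalAt c φ a := by
  rw [evalAt, LinearMap.comp_apply, φ.2.1, varAdd, LinearMap.add_apply, map_add, eval_mulVar,
    eval_map, add_comm]; rfl

theorem evalAt_mul (c : 𝔽) (φ : CDer d) (a b : A) :
    evalAt c φ (a * b) = b * evalAt c φ a + a * evalAt c φ b := by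
  rw [evalAt, LinearMap.comp_apply, φ.2.2, map_add, eval_smul, eval_smul]; rfl

end CDer

/-! ### Twisted action of differential operators on `E × E[λ]`. -/

namespace DiffOp

open LPoly

variable {𝔽 A : Type*} [Field 𝔽] [CommRing A] [Algebra 𝔽 A] {d : Derivation 𝔽 A A}

theorem mono_eq (n : ℕ) (a : A) : (mono n a : DiffOp d) = ofFun a * del d ^ n := by
  have h : ∀ n, (mono n 1 : DiffOp d) = del d ^ n := by
    intro n
    induction n with
    | zero => rfl
    | succ n ih =>
      rw [pow_succ', ← ih, mul_def, del, comp_mono, pow_one, one_smul]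
      refine Eq.trans ?_ (varAdd_single d n 1).symm
      rw [Derivation.map_one_eq_zero, Finsupp.single_zero, add_zero]; rfl
  rw [← h, ofFun_mul]
  refine Eq.trans ?_ (Finsupp.smul_single a n (1 : A)).symm
  rw [smul_eq_mul, mul_one]; rfl

section Module

variable {E : Type*} [AddCommGroup E] [Module 𝔽 E] [Module A E] [Module (DiffOp d) E]
  [IsScalarTower 𝔽 A E] [IsScalarTower 𝔽 (DiffOp d) E] [IsScalarTower A (DiffOp d) E]

theorem ofFun_smul (a : A) (e : E) : (ofFun a : DiffOp d) • e = a • e := by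
  rw [← mul_one (ofFun a : DiffOp d), ofFun_mul, smul_assoc, one_smul]

variable (d) in
theorem delEnd_apply (e : E) : delEnd d E e = del d • e := rfl

variable (d) in
theorem delEnd_smul (a : A) (e : E) : delEnd d E (a • e) = d a • e + a • delEnd d E e := by
  rw [delEnd_apply, delEnd_apply, ← ofFun_smul (d := d), ← ofFun_smul (d := d),
    ← ofFun_smul (d := d), ← mul_smul, ← mul_smul, del_mul_ofFun, add_smul, add_comm]

/-- The operator `(v, p) ↦ (a v, φ_λ(a) v + a p)` on `E × E[λ]`. -/
def extSMul (φ : CDer d) : A →+* AddMonoid.End (E × LPoly E) where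
  toFun a :=
    { toFun := fun x => (a • x.1, mulVec 𝔽 (φ.1 a) x.1 + a • x.2)
      map_zero' := by ext1 <;> simp [mulVec_zero]
      map_add' := fun x y => by
        ext1
        · simp
        · simp only [Prod.fst_add, Prod.snd_add, mulVec_add, smul_add]; abel }
  map_one' := by
    have h := CDer.map_algebraMap φ 1
    rw [map_one] at h
    refine AddMonoidHom.ext fun x => Prod.ext (one_smul _ _) ?_
    change mulVec 𝔽 (φ.1 1) x.1 + (1 : A) • x.2 = x.2
    rw [h, zero_mulVec, one_smul, zero_add]
  -- In the second component, multiplicativity is the Leibniz rule of `φ`.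
  map_mul' a b := by
    refine AddMonoidHom.ext fun x => Prod.ext (mul_smul a b x.1) ?_
    change mulVec 𝔽 (φ.1 (a * b)) x.1 + (a * b) • x.2 =
      mulVec 𝔽 (φ.1 a) (b • x.1) + a • (mulVec 𝔽 (φ.1 b) x.1 + b • x.2)
    rw [φ.2.2, add_mulVec, smul_mulVec', smul_mulVec', mulVec_smul, smul_add, mul_smul, add_assoc]
  map_zero' := by
    refine AddMonoidHom.ext fun x => Prod.ext (zero_smul A x.1) ?_
    change mulVec 𝔽 (φ.1 0) x.1 + (0 : A) • x.2 = 0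
    rw [map_zero, zero_mulVec, zero_smul, zero_add]
  map_add' a b := by
    refine AddMonoidHom.ext fun x => Prod.ext (add_smul a b x.1) ?_
    change mulVec 𝔽 (φ.1 (a + b)) x.1 + (a + b) • x.2 =
      mulVec 𝔽 (φ.1 a) x.1 + a • x.2 + (mulVec 𝔽 (φ.1 b) x.1 + b • x.2)
    rw [map_add, add_mulVec, add_smul]; abel

variable (d E) in
/-- The operator `(v, p) ↦ (∂ v, (∂ + λ) p)` on `E × E[λ]`. -/
def extDel : AddMonoid.End (E × LPoly E) :=
  AddMonoidHom.prodMap (delEnd d E).toAddMonoidHom (map 𝔽 (delEnd d E) + mulVar 𝔽).toAddMonoidHom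

variable (E) in
/-- The action of differential operators on `E × E[λ]`. -/
def extAction (φ : CDer d) : DiffOp d →+* AddMonoid.End (E × LPoly E) :=
  lift (extSMul φ) (extDel d E) fun a => by
    -- The relation `∂ a = a ∂ + ∂(a)` holds in the second component because `φ_λ(∂a) = (∂ +
    -- λ)φ_λ(a)`.
    refine AddMonoidHom.ext fun x => Prod.ext ((delEnd_smul d _ _).trans (add_comm _ _)) ?_
    change map 𝔽 (delEnd d E) (mulVec 𝔽 (φ.1 a) x.1 + a • x.2) +
          mulVar 𝔽 (mulVec 𝔽 (φ.1 a) x.1 + a • x.2) =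
        mulVec 𝔽 (φ.1 a) (delEnd d E x.1) + a • (map 𝔽 (delEnd d E) x.2 + mulVar 𝔽 x.2) +
          (mulVec 𝔽 (φ.1 (d a)) x.1 + d a • x.2)
    have h := map_mulVec_leibniz (delEnd d E) (delEnd_smul d) (φ.1 a) x.1
    rw [map_add, map_add, add_add_add_comm, h, map_smul_leibniz _ (delEnd_smul d), mulVar_smul',
      smul_add, φ.2.1]
    abel

theorem extAction_ofFun (φ : CDer d) (a : A) (x : E × LPoly E) :
    extAction E φ (ofFun a) x = (a • x.1, mulVec 𝔽 (φ.1 a) x.1 + a • x.2) := by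
  have : extAction E φ (ofFun a) = extSMul φ a :=
    (act_mono (d := d) _ _ 0 a).trans (mul_one _)
  rw [this]; rfl

theorem extAction_del (φ : CDer d) (x : E × LPoly E) :
    extAction E φ (del _) x = (delEnd d E x.1, map 𝔽 (delEnd d E) x.2 + mulVar 𝔽 x.2) := by
  have : extAction E φ (del _) = extDel d E :=
    (act_mono (d := d) _ _ 1 1).trans (by rw [map_one, one_mul, pow_one])
  rw [this]; rfl

end Module

end DiffOp

/-! ### Operators on the current module prescribed on generators. -/

namespace CurrentModule

open LPoly Jet

variable {𝔽 R : Type*} [Field 𝔽] [CommRing R] [Algebra 𝔽 R]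

section Basic

variable {F : Type*} [AddCommGroup F] [Module R F]

variable (𝔽 R) in
/-- The generator `1 ⊗ u`. -/
abbrev of (u : F) : CurrentModule 𝔽 R F := 1 ⊗ₜ u

variable (𝔽 R F) in
/-- The action of `∂`. -/
abbrev T : Module.End 𝔽 (CurrentModule 𝔽 R F) := DiffOp.delEnd (deriv 𝔽 R) (CurrentModule 𝔽 R F)

theorem of_add (u v : F) : of 𝔽 R (u + v) = of 𝔽 R u + of 𝔽 R v := TensorProduct.tmul_add _ _ _

theorem of_neg (u : F) : of 𝔽 R (-u) = -of 𝔽 R u := TensorProduct.tmul_neg _ _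

theorem of_smul (r : R) (u : F) : of 𝔽 R (r • u) = ι 𝔽 R r • of 𝔽 R u := by
  rw [of, ← TensorProduct.smul_tmul, TensorProduct.smul_tmul', right_smul_def, one_mul,
    ← DiffOp.ofFun_mul, mul_one]

theorem T_smul (a : Jet 𝔽 R) (y : CurrentModule 𝔽 R F) :
    T 𝔽 R F (a • y) = deriv 𝔽 R a • y + a • T 𝔽 R F y := DiffOp.delEnd_smul _ _ _

theorem mulVec_shiftMul (a : Jet 𝔽 R) (p : LPoly (Jet 𝔽 R)) (v : CurrentModule 𝔽 R F) :
    mulVec 𝔽 (shiftMul (deriv 𝔽 R) a p) v = shiftSMul (T 𝔽 R F) a (mulVec 𝔽 p v) :=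
  shiftMul_mulVec (d := deriv 𝔽 R) (T 𝔽 R F) T_smul a p v

theorem shiftSMul_T_smul (a b : Jet 𝔽 R) (p : LPoly (CurrentModule 𝔽 R F)) :
    shiftSMul (T 𝔽 R F) a (b • p) = b • shiftSMul (T 𝔽 R F) a p :=
  shiftSMul_smul (d := deriv 𝔽 R) (T 𝔽 R F) T_smul a b p

/-- `J_∞ R[∂] ⊗_R F` is generated by `F` as a module over `J_∞ R[∂]`. -/
@[elab_as_elim]
theorem induction {P : CurrentModule 𝔽 R F → Prop} (y : CurrentModule 𝔽 R F)
    (of : ∀ u, P (of 𝔽 R u)) (add : ∀ y z, P y → P z → P (y + z))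
    (smul : ∀ (a : Jet 𝔽 R) (y), P y → P (a • y)) (del : ∀ y, P y → P (T 𝔽 R F y)) : P y := by
  have zero : P 0 := by simpa using smul 0 _ (of 0)
  induction y using TensorProduct.induction_on with
  | zero => exact zero
  | add y z hy hz => exact add y z hy hz
  | tmul Q u =>
    induction Q using DiffOp.induction with
    | zero => rwa [TensorProduct.zero_tmul]
    | add Q Q' h h' => rw [TensorProduct.add_tmul]; exact add _ _ h h'
    | mono n a =>
      have : (DiffOp.mono n a : DiffOp (deriv 𝔽 R)) ⊗ₜ[R] u =
          a • (T 𝔽 R F ^ n) (1 ⊗ₜ u) := by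
        have hn : (T 𝔽 R F ^ n) (1 ⊗ₜ u) = (DiffOp.del (deriv 𝔽 R) ^ n) ⊗ₜ[R] u := by
          induction n with
          | zero => rfl
          | succ n ih =>
            rw [pow_succ', Module.End.mul_apply, ih, pow_succ', DiffOp.delEnd_apply,
              TensorProduct.smul_tmul', smul_eq_mul]
        rw [hn, TensorProduct.smul_tmul', DiffOp.mono_eq, DiffOp.ofFun_mul]
      rw [this]
      refine smul _ _ ?_
      clear this
      induction n with
      | zero => exact of u
      | succ n ih => rw [pow_succ', Module.End.mul_apply]; exact del _ ih

/-- The universal property of `J_∞ R[∂] ⊗_R F`. -/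
theorem exists_addHom {M : Type*} [AddCommGroup M] (ρ : DiffOp (deriv 𝔽 R) →+* AddMonoid.End M)
    (l : F → M) (hadd : ∀ u v, l (u + v) = l u + l v)
    (hsmul : ∀ (r : R) v, l (r • v) = ρ (DiffOp.ofFun (ι 𝔽 R r)) (l v)) :
    ∃ G : CurrentModule 𝔽 R F →+ M, (∀ Q y, G (Q • y) = ρ Q (G y)) ∧
      ∀ v, G (of 𝔽 R v) = l v := by
  let l₁ : F →+ M := AddMonoidHom.mk' l hadd
  let G : CurrentModule 𝔽 R F →+ M :=
    TensorProduct.liftAddHom ((AddMonoidHom.compHom' l₁).comp ρ.toAddMonoidHom) fun r Q v => by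
      change ρ (r • Q) (l v) = ρ Q (l (r • v))
      rw [right_smul_def, map_mul, hsmul]; rfl
  refine ⟨G, fun Q y => ?_, fun v => ?_⟩
  · induction y using TensorProduct.induction_on with
    | zero => rw [smul_zero, map_zero, map_zero]
    | add y z hy hz => rw [smul_add, map_add, hy, hz, map_add, map_add]
    | tmul Q' v =>
      change ρ (Q * Q') (l v) = ρ Q (ρ Q' (l v))
      rw [map_mul]; rfl
  · change ρ 1 (l v) = l v
    rw [map_one]; rfl

/-- `L` is the operator `[x_λ ·]` for some `x` with anchor `φ`, that is `L(∂y) = (∂ + λ) L(y)` and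
`L(a y) = φ_λ(a) y + a L(y)`. -/
structure IsAdjoint (φ : CDer (deriv 𝔽 R))
    (L : CurrentModule 𝔽 R F → LPoly (CurrentModule 𝔽 R F)) : Prop where
  add : ∀ y z, L (y + z) = L y + L z
  del : ∀ y, L (T 𝔽 R F y) = map 𝔽 (T 𝔽 R F) (L y) + mulVar 𝔽 (L y)
  smul : ∀ (a : Jet 𝔽 R) y, L (a • y) = mulVec 𝔽 (φ.1 a) y + a • L y

/-- The three rules propagate equality from the generators. Most identities for the bracket below
are proved this way: both sides are adjoint operators with the same anchor. -/
theorem IsAdjoint.unique {φ : CDer (deriv 𝔽 R)}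
    {L L' : CurrentModule 𝔽 R F → LPoly (CurrentModule 𝔽 R F)} (h : IsAdjoint φ L)
    (h' : IsAdjoint φ L') (hof : ∀ v, L (of 𝔽 R v) = L' (of 𝔽 R v)) (y) : L y = L' y := by
  induction y using CurrentModule.induction with
  | of v => exact hof v
  | add y z hy hz => rw [h.add, h'.add, hy, hz]
  | smul a y hy => rw [h.smul, h'.smul, hy]
  | del y hy => rw [h.del, h'.del, hy]

/-- The operator is built through its graph `y ↦ (y, L y)`, which is linear for the twisted action;
`hsmul` is the compatibility of the prescribed values with the tensor product over `R`. -/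
theorem exists_isAdjoint (φ : CDer (deriv 𝔽 R)) (l : F → LPoly (CurrentModule 𝔽 R F))
    (hadd : ∀ u v, l (u + v) = l u + l v)
    (hsmul : ∀ (r : R) v, l (r • v) = mulVec 𝔽 (φ.1 (ι 𝔽 R r)) (of 𝔽 R v) + ι 𝔽 R r • l v) :
    ∃ L : CurrentModule 𝔽 R F →ₗ[𝔽] LPoly (CurrentModule 𝔽 R F),
      IsAdjoint φ L ∧ ∀ v, L (of 𝔽 R v) = l v := by
  obtain ⟨G, hG, hof⟩ := exists_addHom (DiffOp.extAction (CurrentModule 𝔽 R F) φ)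
    (fun v => (of 𝔽 R v, l v)) (fun u v => Prod.ext (of_add u v) (hadd u v)) fun r v =>
      (Prod.ext (of_smul r v) (hsmul r v)).trans (DiffOp.extAction_ofFun φ _ _).symm
  have hdel : ∀ y, G (T 𝔽 R F y) = (T 𝔽 R F (G y).1, map 𝔽 (T 𝔽 R F) (G y).2 + mulVar 𝔽 (G y).2) :=
    fun y => by rw [DiffOp.delEnd_apply, hG, DiffOp.extAction_del]
  have hmul : ∀ (a : Jet 𝔽 R) y, G (a • y) = (a • (G y).1, mulVec 𝔽 (φ.1 a) (G y).1 + a • (G y).2) :=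
    fun a y => by rw [← DiffOp.ofFun_smul (d := deriv 𝔽 R) a y, hG, DiffOp.extAction_ofFun]
  -- The first component of `G` is linear and fixes the generators. Only then does the term
  -- `φ_λ(a)(G y).1` become the Leibniz term `φ_λ(a) y`.
  have hfst : ∀ y, (G y).1 = y := by
    intro y
    induction y using CurrentModule.induction with
    | of v => rw [hof]
    | add y z hy hz => rw [map_add, Prod.fst_add, hy, hz]
    | smul a y hy => rw [hmul, hy]
    | del y hy => rw [hdel, hy]
  refine ⟨{ toFun := fun y => (G y).2
            map_add' := fun y z => by rw [map_add]; rfl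
            map_smul' := fun c y => ?_ }, ⟨fun y z => ?_, fun y => ?_, fun a y => ?_⟩, fun v => ?_⟩
  -- Linearity over `𝔽` is the Leibniz rule at a constant, which `φ` kills.
  · rw [← algebraMap_smul (Jet 𝔽 R) c y, hmul, CDer.map_algebraMap, zero_mulVec, zero_add]
    exact algebraMap_smul _ _ _
  · exact map_add _ _ _
  · exact congrArg Prod.snd (hdel y)
  · refine (congrArg Prod.snd (hmul a y)).trans ?_
    rw [hfst]; rfl
  · exact congrArg Prod.snd (hof v)

end Basic

end CurrentModule

/-! ### Anchor and bracket of the current algebroid; skew-symmetry. -/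

namespace CurrentModule

open LPoly Jet

variable {𝔽 R : Type*} [Field 𝔽] [CommRing R] [Algebra 𝔽 R]

section Lie

variable {F : Type*} [LieRing F] [LieAlgebra 𝔽 F] [Module R F] [LieRingModule F R]
  [LieRinehartRing R F] [LieRinehartAlgebra 𝔽 R F]

variable (𝔽 R) in
/-- The conformal lift of the derivation `θ(u)`. -/
def liftAnchor (u : F) : CDer (deriv 𝔽 R) := conformalLift (LieRinehartAlgebra.anchor 𝔽 R F u)

theorem liftAnchor_ι (u : F) (r : R) :
    (liftAnchor 𝔽 R u).1 (ι 𝔽 R r) = const (ι 𝔽 R ⁅u, r⁆) := isConformalLift _ r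

theorem liftAnchor_add (u v : F) :
    liftAnchor 𝔽 R (u + v) = liftAnchor 𝔽 R u + liftAnchor 𝔽 R v := by
  rw [liftAnchor, map_add, conformalLift_add]; rfl

theorem liftAnchor_smul (r : R) (u : F) :
    liftAnchor 𝔽 R (r • u) =
      (DiffOp.ofFun (ι 𝔽 R r) : DiffOp (deriv 𝔽 R)) • liftAnchor 𝔽 R u := by
  rw [liftAnchor, LieRinehartAlgebra.Hom.map_smul_apply, AlgHom.id_apply, conformalLift_smul]; rfl

variable (𝔽 R F) in
theorem exists_anchor : ∃ θ : CurrentModule 𝔽 R F →ₗ[DiffOp (deriv 𝔽 R)] CDer (deriv 𝔽 R),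
    ∀ u, θ (of 𝔽 R u) = liftAnchor 𝔽 R u := by
  obtain ⟨G, hG, hof⟩ := exists_addHom
    (Module.toAddMonoidEnd (DiffOp (deriv 𝔽 R)) (CDer (deriv 𝔽 R))) (liftAnchor 𝔽 R (F := F))
    liftAnchor_add liftAnchor_smul
  exact ⟨{ G with map_smul' := hG }, hof⟩

variable (𝔽 R F) in
/-- The anchor map of the current Lie conformal algebroid. -/
def anchor : CurrentModule 𝔽 R F →ₗ[DiffOp (deriv 𝔽 R)] CDer (deriv 𝔽 R) :=
  (exists_anchor 𝔽 R F).choose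

theorem anchor_of (u : F) : anchor 𝔽 R F (of 𝔽 R u) = liftAnchor 𝔽 R u :=
  (exists_anchor 𝔽 R F).choose_spec u

theorem anchor_smul (a : Jet 𝔽 R) (y : CurrentModule 𝔽 R F) :
    anchor 𝔽 R F (a • y) = (DiffOp.ofFun a : DiffOp (deriv 𝔽 R)) • anchor 𝔽 R F y := by
  rw [← map_smul, DiffOp.ofFun_smul a y]

theorem anchor_T (y : CurrentModule 𝔽 R F) :
    anchor 𝔽 R F (T 𝔽 R F y) = DiffOp.del (deriv 𝔽 R) • anchor 𝔽 R F y := map_smul _ _ _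

theorem anchor_smul_apply (a : Jet 𝔽 R) (y : CurrentModule 𝔽 R F) (b : Jet 𝔽 R) :
    (anchor 𝔽 R F (a • y)).1 b = shiftMul (deriv 𝔽 R) a ((anchor 𝔽 R F y).1 b) := by
  rw [anchor_smul, CDer.ofFun_smul_apply]

theorem anchor_T_apply (y : CurrentModule 𝔽 R F) (b : Jet 𝔽 R) :
    (anchor 𝔽 R F (T 𝔽 R F y)).1 b = -mulVar 𝔽 ((anchor 𝔽 R F y).1 b) := by
  rw [anchor_T, CDer.del_smul_apply]

variable (𝔽 R F) in
/-- The anchor map, as an `𝔽`-linear map. -/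
def anchorL : CurrentModule 𝔽 R F →ₗ[𝔽] Jet 𝔽 R →ₗ[𝔽] LPoly (Jet 𝔽 R) where
  toFun y := (anchor 𝔽 R F y).1
  map_add' y z := by rw [map_add]; rfl
  map_smul' c y := by
    refine LinearMap.ext fun b => ?_
    rw [← algebraMap_smul (Jet 𝔽 R) c y, anchor_smul_apply]
    exact shiftMul_algebraMap _ _ _

namespace IsAdjoint

variable {φ ψ : CDer (deriv 𝔽 R)} {L L' : CurrentModule 𝔽 R F → LPoly (CurrentModule 𝔽 R F)}

theorem add_fun (h : IsAdjoint φ L) (h' : IsAdjoint ψ L') :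
    IsAdjoint (φ + ψ) fun y => L y + L' y where
  add y z := by rw [h.add, h'.add]; abel
  del y := by rw [h.del, h'.del, map_add, map_add]; abel
  smul a y := by
    rw [h.smul, h'.smul, Submodule.coe_add, LinearMap.add_apply, add_mulVec, smul_add]; abel

theorem smul_fun (c : 𝔽) (h : IsAdjoint φ L) : IsAdjoint (c • φ) fun y => c • L y where
  add y z := by rw [h.add, smul_add]
  del y := by rw [h.del, map_smul, map_smul, smul_add]
  smul a y := by
    rw [h.smul, Submodule.coe_smul, LinearMap.smul_apply, smul_mulVec, smul_add, smul_comm a c]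

theorem del_fun (h : IsAdjoint φ L) :
    IsAdjoint (DiffOp.del (deriv 𝔽 R) • φ) fun y => -mulVar 𝔽 (L y) where
  add y z := by rw [h.add, map_add, neg_add]
  del y := by rw [h.del, map_add, map_neg, map_neg, map_mulVar]; abel
  smul a y := by
    rw [h.smul, CDer.del_smul_apply, neg_mulVec, mulVec_mulVar, map_add, mulVar_smul', smul_neg,
      neg_add]

/-- The operator `[a x_λ ·]`, where `L` is `[x_λ ·]`. -/
theorem smul_left (h : IsAdjoint φ L) (a : Jet 𝔽 R) (x : CurrentModule 𝔽 R F) :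
    IsAdjoint ((DiffOp.ofFun a : DiffOp (deriv 𝔽 R)) • φ) fun y =>
      shiftSMul (T 𝔽 R F) a (L y) - reflect (T 𝔽 R F) (mulVec 𝔽 ((anchor 𝔽 R F y).1 a) x) where
  add y z := by
    rw [h.add, shiftSMul_add, map_add, Submodule.coe_add, LinearMap.add_apply, add_mulVec, map_add]
    abel
  del y := by
    rw [h.del, shiftSMul_map_add_mulVar, anchor_T_apply, neg_mulVec, mulVec_mulVar,
      reflect_neg_mulVar, map_sub, map_sub]
    abel
  smul b y := by
    -- The shifted Leibniz term `φ_λ(b) y` provides the anchor of `a x`. In the subtracted term `b`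
    -- enters as a shifted factor, which reflection turns into an ordinary one.
    rw [h.smul, CDer.ofFun_smul_apply, shiftSMul_add, mulVec_shiftMul, shiftSMul_T_smul,
      anchor_smul_apply, mulVec_shiftMul, reflect_shiftSMul]
    rw [smul_sub, add_sub_assoc]

end IsAdjoint

variable (𝔽 R) in
-- The compatibility over `R` demanded by `exists_isAdjoint` is the Leibniz rule of `F`.
theorem exists_ad (u : F) : ∃ L : CurrentModule 𝔽 R F →ₗ[𝔽] LPoly (CurrentModule 𝔽 R F),
    IsAdjoint (liftAnchor 𝔽 R u) L ∧ ∀ v, L (of 𝔽 R v) = const (of 𝔽 R ⁅u, v⁆) := by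
  refine exists_isAdjoint _ (fun v => const (of 𝔽 R ⁅u, v⁆)) (fun v w => ?_) fun r v => ?_
  · rw [lie_add, of_add, const_add]
  · rw [LieRinehartRing.leibniz_smul_right, liftAnchor_ι, mulVec_const, of_add, of_smul, of_smul,
      const_add, const_smul (ι 𝔽 R r), add_comm]

variable (𝔽 R) in
/-- The operator `[1 ⊗ u_λ ·]`. -/
def ad (u : F) : CurrentModule 𝔽 R F →ₗ[𝔽] LPoly (CurrentModule 𝔽 R F) := (exists_ad 𝔽 R u).choose

theorem isAdjoint_ad (u : F) : IsAdjoint (liftAnchor 𝔽 R u) (ad 𝔽 R u) :=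
  (exists_ad 𝔽 R u).choose_spec.1

theorem ad_of (u v : F) : ad 𝔽 R u (of 𝔽 R v) = const (of 𝔽 R ⁅u, v⁆) :=
  (exists_ad 𝔽 R u).choose_spec.2 v

theorem ad_add (u v : F) (y : CurrentModule 𝔽 R F) :
    ad 𝔽 R (u + v) y = ad 𝔽 R u y + ad 𝔽 R v y := by
  have h := isAdjoint_ad (𝔽 := 𝔽) (R := R) (u + v)
  rw [liftAnchor_add] at h
  refine h.unique ((isAdjoint_ad u).add_fun (isAdjoint_ad v)) (fun w => ?_) y
  rw [ad_of, ad_of, ad_of, add_lie, of_add, const_add]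

/-- The right-hand side is forced: by skew-symmetry `[ru_λ y]` is minus the reflection of `[y_λ ru]
= θ(y)_λ(r) u + r [y_λ u]`. On generators it reads `[ru, w] = r[u, w] - θ(w)(r)u`, and
`IsAdjoint.unique` does the rest. -/
theorem ad_smul (r : R) (u : F) (y : CurrentModule 𝔽 R F) :
    ad 𝔽 R (r • u) y = shiftSMul (T 𝔽 R F) (ι 𝔽 R r) (ad 𝔽 R u y) -
      reflect (T 𝔽 R F) (mulVec 𝔽 ((anchor 𝔽 R F y).1 (ι 𝔽 R r)) (of 𝔽 R u)) := by
  have h := isAdjoint_ad (𝔽 := 𝔽) (R := R) (r • u)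
  rw [liftAnchor_smul] at h
  refine h.unique ((isAdjoint_ad u).smul_left _ _) (fun w => ?_) y
  rw [ad_of, ad_of, shiftSMul_const, anchor_of, liftAnchor_ι, mulVec_const, reflect_const,
    ← lie_skew, LieRinehartRing.leibniz_smul_right, ← of_smul, ← of_smul, ← lie_skew u w,
    sub_eq_add_neg]
  rw [neg_add, of_add, of_neg, smul_neg, of_neg, const_add, const_neg, const_neg,
    of_neg, const_neg]

/-- Skew-symmetry dictates the values on generators. Reflecting `ad_smul` yields the Leibniz rule
they must satisfy: the shifted product becomes an ordinary one and the anchor term is reflected back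
to itself. -/
theorem exists_bracket (x : CurrentModule 𝔽 R F) :
    ∃ L : CurrentModule 𝔽 R F →ₗ[𝔽] LPoly (CurrentModule 𝔽 R F),
      IsAdjoint (anchor 𝔽 R F x) L ∧ ∀ v, L (of 𝔽 R v) = -reflect (T 𝔽 R F) (ad 𝔽 R v x) := by
  refine exists_isAdjoint _ (fun v => -reflect (T 𝔽 R F) (ad 𝔽 R v x)) (fun v w => ?_)
    fun r v => ?_
  · rw [ad_add, map_add, neg_add]
  · rw [ad_smul, map_sub, reflect_shiftSMul, reflect_reflect, smul_neg]; abel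

/-- The operator `[x_λ ·]`. -/
def bracketFun (x : CurrentModule 𝔽 R F) :
    CurrentModule 𝔽 R F →ₗ[𝔽] LPoly (CurrentModule 𝔽 R F) := (exists_bracket x).choose

theorem isAdjoint_bracketFun (x : CurrentModule 𝔽 R F) :
    IsAdjoint (anchor 𝔽 R F x) (bracketFun x) := (exists_bracket x).choose_spec.1

theorem bracketFun_of (x : CurrentModule 𝔽 R F) (v : F) :
    bracketFun x (of 𝔽 R v) = -reflect (T 𝔽 R F) (ad 𝔽 R v x) := (exists_bracket x).choose_spec.2 v

variable (𝔽 R F) in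
/-- The bracket of the current Lie conformal algebroid. -/
def bracket : CurrentModule 𝔽 R F →ₗ[𝔽] CurrentModule 𝔽 R F →ₗ[𝔽] LPoly (CurrentModule 𝔽 R F) where
  toFun := bracketFun
  map_add' x y := by
    refine LinearMap.ext fun z => ?_
    have h := isAdjoint_bracketFun (x + y)
    rw [map_add] at h
    refine h.unique ((isAdjoint_bracketFun x).add_fun (isAdjoint_bracketFun y)) (fun w => ?_) z
    simp only [bracketFun_of, map_add, neg_add]
  map_smul' c x := by
    refine LinearMap.ext fun z => ?_
    have h := isAdjoint_bracketFun (c • x)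
    have hc : anchor 𝔽 R F (c • x) = c • anchor 𝔽 R F x := Subtype.ext ((anchorL 𝔽 R F).map_smul c x)
    rw [hc] at h
    refine h.unique ((isAdjoint_bracketFun x).smul_fun c) (fun w => ?_) z
    simp only [bracketFun_of, map_smul, smul_neg]

theorem isAdjoint_bracket (x : CurrentModule 𝔽 R F) :
    IsAdjoint (anchor 𝔽 R F x) (bracket 𝔽 R F x) := isAdjoint_bracketFun x

theorem bracket_of_right (x : CurrentModule 𝔽 R F) (v : F) :
    bracket 𝔽 R F x (of 𝔽 R v) = -reflect (T 𝔽 R F) (ad 𝔽 R v x) := bracketFun_of x v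

theorem bracket_of_of (u v : F) :
    bracket 𝔽 R F (of 𝔽 R u) (of 𝔽 R v) = const (of 𝔽 R ⁅u, v⁆) := by
  rw [bracket_of_right, ad_of, reflect_const, ← lie_skew u v]
  rw [of_neg, const_neg]

/-- The two stages of the construction agree: they have the same anchor and, by antisymmetry in `F`,
the same values on generators. -/
theorem bracket_of_left (u : F) (y : CurrentModule 𝔽 R F) :
    bracket 𝔽 R F (of 𝔽 R u) y = ad 𝔽 R u y := by
  have h := isAdjoint_bracket (of 𝔽 R u)
  rw [anchor_of] at h
  exact h.unique (isAdjoint_ad u) (fun v => by rw [bracket_of_of, ad_of]) y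

theorem bracket_T_left (x y : CurrentModule 𝔽 R F) :
    bracket 𝔽 R F (T 𝔽 R F x) y = -mulVar 𝔽 (bracket 𝔽 R F x y) := by
  have h := isAdjoint_bracket (T 𝔽 R F x)
  rw [anchor_T] at h
  refine h.unique (isAdjoint_bracket x).del_fun (fun v => ?_) y
  rw [bracket_of_right, bracket_of_right, (isAdjoint_ad v).del, reflect_map_add_mulVar, map_neg]

theorem bracket_smul_left (a : Jet 𝔽 R) (x y : CurrentModule 𝔽 R F) :
    bracket 𝔽 R F (a • x) y = shiftSMul (T 𝔽 R F) a (bracket 𝔽 R F x y) -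
      reflect (T 𝔽 R F) (mulVec 𝔽 ((anchor 𝔽 R F y).1 a) x) := by
  have h := isAdjoint_bracket (a • x)
  rw [anchor_smul] at h
  refine h.unique ((isAdjoint_bracket x).smul_left a x) (fun v => ?_) y
  rw [bracket_of_right, bracket_of_right, (isAdjoint_ad v).smul, map_add, reflect_smul, anchor_of,
    shiftSMul_neg]
  abel

/-- For `y = 1 ⊗ v` this is the definition of the bracket together with `bracket_of_left`. It
spreads to all `y` because reflection exchanges the left and right rules for `a` and `∂`. -/
theorem bracket_skew (x y : CurrentModule 𝔽 R F) :
    bracket 𝔽 R F y x = -reflect (T 𝔽 R F) (bracket 𝔽 R F x y) := by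
  induction y using CurrentModule.induction with
  | of v => rw [bracket_of_left, bracket_of_right, map_neg, neg_neg, reflect_reflect]
  | add y z hy hz => rw [map_add, LinearMap.add_apply, hy, hz, map_add, map_add, neg_add]
  | smul a y hy =>
    rw [bracket_smul_left, hy, (isAdjoint_bracket x).smul, map_add, reflect_smul, shiftSMul_neg]
    abel
  | del y hy => rw [bracket_T_left, hy, (isAdjoint_bracket x).del, reflect_map_add_mulVar, map_neg]

end Lie
end CurrentModule

/-! ### Cyclic rotation of the Jacobi identity. -/

namespace LPoly

variable {𝔽 : Type*} [Field 𝔽] {E V : Type*} [AddCommGroup E] [Module 𝔽 E]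
  [AddCommGroup V] [Module 𝔽 V]

theorem substL_smul_one (c : 𝔽) (f : E →ₗ[𝔽] V) (p : LPoly E) :
    substL (c • 1) f p = f (eval c p) := (eval_map c f p).symm.trans (substL_map _ _ _ _) |>.symm

theorem substL_neg (S : Module.End 𝔽 V) (f : E →ₗ[𝔽] V) (p : LPoly E) :
    substL S (-f) p = -substL S f p := by
  induction p using LPoly.induction 𝔽 E with
  | const e => rw [substL_const, substL_const]; rfl
  | add p q hp hq => simp only [map_add, hp, hq, neg_add]
  | mulVar p hp => rw [substL_mulVar, substL_mulVar, hp, map_neg]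

variable (T : Module.End 𝔽 E) (B : E →ₗ[𝔽] E →ₗ[𝔽] LPoly E)

/-- The Jacobi identity for a triple implies that for the cyclically permuted triple. -/
theorem jacobi_rotate [Infinite 𝔽]
    (hdel : ∀ u v, B u (T v) = map 𝔽 T (B u v) + mulVar 𝔽 (B u v))
    (hskew : ∀ u v, B v u = -reflect T (B u v)) {u v w : E}
    (hJ : ∀ a b : 𝔽, eval a (B w (eval b (B u v))) - eval b (B u (eval a (B w v))) =
      eval (a + b) (B (eval a (B w u)) v)) (a b : 𝔽) :
    eval a (B u (eval b (B v w))) - eval b (B v (eval a (B u w))) =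
      eval (a + b) (B (eval a (B u v)) w) := by
  -- The hypothesis with its second variable at `a` and its first kept formal. A polynomial identity
  -- is needed because the operator `-(a + b) - T`, not a scalar, will be substituted.
  have hp : B w (eval a (B u v)) - map 𝔽 (eval a ∘ₗ B u) (B w v) =
      substL (mulVar 𝔽) (translate a ∘ₗ B.flip v) (B w u) := ext_eval fun c => by
    rw [map_sub, eval_map, LinearMap.comp_apply, hJ, eval_substL (S' := c • 1) c (eval_mulVar c),
      substL_smul_one]
    exact (eval_translate _ _ _).symm
  have hr : ∀ (c : 𝔽) (x y : E), eval c (B x y) = -evalEnd (-(c • 1) - T) (B y x) := fun c x y => by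
    rw [hskew y x, map_neg, eval_reflect]
  -- By sesquilinearity `T` passes through `eval c ∘ B x` as `T + c`, so `-e - T` comes out as `-(e
  -- + c) - T`.
  have hc : ∀ (c e : 𝔽) (x : E) (q : LPoly E), eval c (B x (evalEnd (-(e • 1) - T) q)) =
      substL (-((e + c) • 1) - T) (eval c ∘ₗ B x) q := fun c e x q => by
    refine apply_substL (eval c ∘ₗ B x) (fun y => ?_) LinearMap.id q
    simp only [LinearMap.sub_apply, LinearMap.neg_apply, LinearMap.smul_apply,
      Module.End.one_apply, map_sub, map_neg, map_smul, LinearMap.comp_apply, hdel, map_add,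
      eval_map, eval_mulVar, add_smul, LinearMap.add_apply]
    abel
  -- By skew-symmetry this substitution turns each bracket with `w` on the left into one with `w` on
  -- the right; the three terms become those of the rotated identity.
  have h1 := congrArg (evalEnd (-((a + b) • 1) - T)) hp
  rw [map_sub, evalEnd, substL_map, ← evalEnd, ← neg_eq_iff_eq_neg.2 (hr (a + b) _ w)] at h1
  have h2 : evalEnd (-((a + b) • 1) - T)
      (substL (mulVar 𝔽) (translate a ∘ₗ B.flip v) (B w u)) =
        eval b (B v (eval a (B u w))) := by
    rw [hr a u w, map_neg, map_neg, hc,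
      apply_substL _ (S' := -((a + b) • 1) - T) (evalEnd_mulVar _), ← substL_neg]
    refine congrArg (fun f : E →ₗ[𝔽] E => substL (-((a + b) • 1) - T) f (B w u))
      (LinearMap.ext fun e => ?_)
    rw [LinearMap.neg_apply, LinearMap.comp_apply, LinearMap.comp_apply, LinearMap.comp_apply,
      LinearMap.flip_apply, evalEnd_translate, hr b v e, neg_neg, add_smul]
    congr 2
    abel
  rw [h2] at h1
  rw [hr b v w, map_neg, map_neg, hc, add_comm b a, ← h1, LinearMap.id_comp]
  abel

end LPoly

/-! ### Coefficientwise action of an evaluated conformal derivation. -/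

namespace CDer

open LPoly

variable {𝔽 A : Type*} [Field 𝔽] [CommRing A] [Algebra 𝔽 A] {d : Derivation 𝔽 A A}

theorem map_evalAt_smul (c : 𝔽) (φ : CDer d) (a : A) (p : LPoly A) :
    map 𝔽 (evalAt c φ) (a • p) = evalAt c φ a • p + a • map 𝔽 (evalAt c φ) p := by
  ext n
  refine (evalAt_mul c φ a (p n)).trans ?_
  rw [mul_comm, Finsupp.add_apply, Finsupp.smul_apply, Finsupp.smul_apply]; rfl

theorem map_evalAt_varAdd (c : 𝔽) (φ : CDer d) (p : LPoly A) :
    map 𝔽 (evalAt c φ) (varAdd d p) =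
      varAdd d (map 𝔽 (evalAt c φ) p) + c • map 𝔽 (evalAt c φ) p := by
  have : map 𝔽 (evalAt c φ) (map 𝔽 (d : A →ₗ[𝔽] A) p) =
      map 𝔽 (d : A →ₗ[𝔽] A) (map 𝔽 (evalAt c φ) p) + c • map 𝔽 (evalAt c φ) p := by
    ext n; exact evalAt_deriv c φ (p n)
  rw [varAdd, LinearMap.add_apply, map_add, map_mulVar, this, LinearMap.add_apply, add_assoc]

end CDer

/-! ### Anchor compatibility, Jacobi identity, existence and uniqueness. -/

namespace CurrentModule

open LPoly Jet CDer

variable {𝔽 R : Type*} [Field 𝔽] [CommRing R] [Algebra 𝔽 R]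
  {F : Type*} [LieRing F] [LieAlgebra 𝔽 F] [Module R F] [LieRingModule F R]
  [LieRinehartRing R F] [LieRinehartAlgebra 𝔽 R F]

theorem evalAt_anchor_of_ι (c : 𝔽) (u : F) (r : R) :
    evalAt c (anchor 𝔽 R F (of 𝔽 R u)) (ι 𝔽 R r) = ι 𝔽 R ⁅u, r⁆ := by
  rw [evalAt, LinearMap.comp_apply, anchor_of, liftAnchor_ι, eval_const]

theorem eval_bracket_smul (c : 𝔽) (x y : CurrentModule 𝔽 R F) (a : Jet 𝔽 R) :
    eval c (bracket 𝔽 R F x (a • y)) =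
      evalAt c (anchor 𝔽 R F x) a • y + a • eval c (bracket 𝔽 R F x y) := by
  rw [(isAdjoint_bracket x).smul, map_add, eval_mulVec, eval_smul]; rfl

theorem eval_bracket_T (c : 𝔽) (x y : CurrentModule 𝔽 R F) :
    eval c (bracket 𝔽 R F x (T 𝔽 R F y)) =
      T 𝔽 R F (eval c (bracket 𝔽 R F x y)) + c • eval c (bracket 𝔽 R F x y) := by
  rw [(isAdjoint_bracket x).del, map_add, eval_map, eval_mulVar]

theorem anchor_add_apply (x y : CurrentModule 𝔽 R F) (a : Jet 𝔽 R) :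
    (anchor 𝔽 R F (x + y)).1 a = (anchor 𝔽 R F x).1 a + (anchor 𝔽 R F y).1 a := by
  rw [map_add]; rfl

theorem anchor_scalar_apply (c : 𝔽) (y : CurrentModule 𝔽 R F) (a : Jet 𝔽 R) :
    (anchor 𝔽 R F (c • y)).1 a = c • (anchor 𝔽 R F y).1 a :=
  congrArg (fun f : Jet 𝔽 R →ₗ[𝔽] LPoly (Jet 𝔽 R) => f a) ((anchorL 𝔽 R F).map_smul c y)

/-- Compatibility of the anchor map with the bracket of `x` and `y`, the first variable being
specialized to a scalar. -/
def AnchorBracket (x y : CurrentModule 𝔽 R F) : Prop :=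
  ∀ (c : 𝔽) (a : Jet 𝔽 R), map 𝔽 (evalAt c (anchor 𝔽 R F x)) ((anchor 𝔽 R F y).1 a) -
    (anchor 𝔽 R F y).1 (evalAt c (anchor 𝔽 R F x) a) =
      translate c ((anchor 𝔽 R F (eval c (bracket 𝔽 R F x y))).1 a)

/-- Both sides, as functions of `a`, obey the Leibniz rule and intertwine `∂` with `∂ + λ + c`, so
`a = ι(r)` suffices. There the claim is that the anchor of `F` preserves brackets. -/
theorem anchorBracket_of_of (u v : F) : AnchorBracket (of 𝔽 R u) (of 𝔽 R v) := by
  intro c a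
  have hb : eval c (bracket 𝔽 R F (of 𝔽 R u) (of 𝔽 R v)) = of 𝔽 R ⁅u, v⁆ := by
    rw [bracket_of_of, eval_const]
  rw [hb]
  induction a using Jet.induction with
  | ι r =>
    rw [evalAt_anchor_of_ι, anchor_of v, anchor_of ⁅u, v⁆, liftAnchor_ι, liftAnchor_ι, liftAnchor_ι,
      map_const, evalAt_anchor_of_ι, translate_const, lie_lie, map_sub, sub_eq_add_neg,
      sub_eq_add_neg, const_add, const_neg]
  | add a b ha hb =>
    simp only [map_add, ← ha, ← hb]; abel
  | mul a b ha hb =>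
    rw [CDer.evalAt_mul, map_add ((anchor 𝔽 R F (of 𝔽 R v)).1)]
    simp only [(anchor 𝔽 R F (of 𝔽 R v)).2.2, (anchor 𝔽 R F (of 𝔽 R ⁅u, v⁆)).2.2]
    rw [map_add, map_add, map_evalAt_smul, map_evalAt_smul, translate_smul, translate_smul, ← ha,
      ← hb, smul_sub, smul_sub]
    abel
  | deriv a ha =>
    rw [evalAt_deriv, map_add ((anchor 𝔽 R F (of 𝔽 R v)).1)]
    simp only [(anchor 𝔽 R F (of 𝔽 R v)).2.1, (anchor 𝔽 R F (of 𝔽 R ⁅u, v⁆)).2.1]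
    rw [map_evalAt_varAdd, translate_varAdd, ← ha, map_sub, map_smul, smul_sub]
    abel

/-- For `b y`, the extra term of `map_shiftMul` is the anchor of the Leibniz term `θ(x)_c(b) y`. For
`∂ y`, translation turns `-λ` into `-(λ + c)`, and the summand `c [x_c y]` compensates. -/
theorem AnchorBracket.right {x : CurrentModule 𝔽 R F} (h : ∀ v, AnchorBracket x (of 𝔽 R v))
    (y : CurrentModule 𝔽 R F) : AnchorBracket x y := by
  induction y using CurrentModule.induction with
  | of v => exact h v
  | add y z hy hz =>
    intro c a
    rw [anchor_add_apply, anchor_add_apply, map_add, map_add, map_add, anchor_add_apply, map_add,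
      ← hy, ← hz]
    abel
  | smul b y hy =>
    intro c a
    rw [anchor_smul_apply, anchor_smul_apply, eval_bracket_smul, anchor_add_apply,
      anchor_smul_apply, anchor_smul_apply, map_add, translate_shiftMul _ c b, ← hy,
      map_shiftMul (deriv 𝔽 R) c (evalAt c (anchor 𝔽 R F x)) (evalAt_deriv c _) (evalAt_mul c _),
      map_sub]
    abel
  | del y hy =>
    intro c a
    rw [anchor_T_apply, anchor_T_apply, eval_bracket_T, anchor_add_apply, anchor_T_apply,
      anchor_scalar_apply, map_add, map_neg, map_neg, translate_mulVar, map_smul, map_mulVar, ← hy,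
      map_sub]
    abel

theorem AnchorBracket.evalAt {x y : CurrentModule 𝔽 R F} (h : AnchorBracket x y) (c e : 𝔽)
    (a : Jet 𝔽 R) : evalAt c (anchor 𝔽 R F x) (evalAt e (anchor 𝔽 R F y) a) -
      evalAt e (anchor 𝔽 R F y) (evalAt c (anchor 𝔽 R F x) a) =
        CDer.evalAt (e + c) (anchor 𝔽 R F (eval c (bracket 𝔽 R F x y))) a := by
  have := congrArg (eval e) (h c a)
  rwa [map_sub, eval_map, eval_translate] at this

theorem AnchorBracket.swap [Infinite 𝔽] {x y : CurrentModule 𝔽 R F} (h : AnchorBracket x y) :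
    AnchorBracket y x := by
  intro c a
  refine ext_eval (𝔽 := 𝔽) fun e => ?_
  rw [map_sub, eval_map, eval_translate]
  have h1 := h.evalAt e c a
  let f : CurrentModule 𝔽 R F →ₗ[𝔽] Jet 𝔽 R := eval (e + c) ∘ₗ (anchorL 𝔽 R F).flip a
  have hf : ∀ z, f (T 𝔽 R F z) = -((e + c) • f z) := fun z => by
    change eval (e + c) ((anchor 𝔽 R F (T 𝔽 R F z)).1 a) = _
    rw [anchor_T_apply, map_neg, eval_mulVar]; rfl
  -- Under `f` the operator `∂` becomes `-(e + c)`, so the reflected variable `-c - ∂` becomes the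
  -- scalar `e`.
  have h2 : f (eval c (bracket 𝔽 R F y x)) = -f (eval e (bracket 𝔽 R F x y)) := by
    rw [bracket_skew x y, map_neg, map_neg, eval_reflect, ← substL_smul_one]
    refine congrArg _ ((apply_substL f (fun z => ?_) LinearMap.id _).trans rfl)
    simp only [LinearMap.sub_apply, LinearMap.neg_apply, LinearMap.smul_apply,
      Module.End.one_apply, map_sub, map_neg, map_smul, hf, add_smul]
    abel
  refine Eq.trans ?_ h2.symm
  rw [add_comm c e] at h1
  refine Eq.trans ?_ (congrArg Neg.neg h1)
  rw [neg_sub]; rfl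

/-- Extend the right argument from the generators, swap, and extend again. -/
theorem anchorBracket [Infinite 𝔽] (x y : CurrentModule 𝔽 R F) : AnchorBracket x y :=
  .right (fun v => (AnchorBracket.right (fun u => anchorBracket_of_of v u) x).swap) y

/-- The Jacobi identity for `x`, `y`, `z`, the variables being specialized to scalars. -/
def Jacobi (x y z : CurrentModule 𝔽 R F) : Prop :=
  ∀ a b : 𝔽, eval a (bracket 𝔽 R F x (eval b (bracket 𝔽 R F y z))) -
    eval b (bracket 𝔽 R F y (eval a (bracket 𝔽 R F x z))) =
      eval (a + b) (bracket 𝔽 R F (eval a (bracket 𝔽 R F x y)) z)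

theorem jacobi_of (u v w : F) : Jacobi (of 𝔽 R u) (of 𝔽 R v) (of 𝔽 R w) := by
  intro a b
  simp only [bracket_of_of, eval_const]
  rw [lie_lie, sub_eq_add_neg ⁅u, ⁅v, w⁆⁆, of_add, of_neg, sub_eq_add_neg]

theorem Jacobi.rotate [Infinite 𝔽] {x y z : CurrentModule 𝔽 R F} (h : Jacobi z x y) :
    Jacobi x y z :=
  jacobi_rotate (T 𝔽 R F) (bracket 𝔽 R F) (fun x => (isAdjoint_bracket x).del) bracket_skew h

/-- For `c z`, the Leibniz terms leave the commutator of the two anchors applied to `c`, times `z`;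
`anchorBracket` identifies it with the anchor of the bracket. -/
theorem Jacobi.right [Infinite 𝔽] {x y : CurrentModule 𝔽 R F} (h : ∀ w, Jacobi x y (of 𝔽 R w))
    (z : CurrentModule 𝔽 R F) : Jacobi x y z := by
  induction z using CurrentModule.induction with
  | of w => exact h w
  | add z z' hz hz' =>
    intro a b
    simp only [map_add, ← hz a b, ← hz' a b]; abel
  | smul c z hz =>
    intro a b
    have hs : ∀ p q : Jet 𝔽 R, (p - q) • z = p • z - q • z := fun p q => sub_smul p q z
    rw [eval_bracket_smul, eval_bracket_smul, eval_bracket_smul, map_add, map_add, map_add,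
      map_add, eval_bracket_smul, eval_bracket_smul, eval_bracket_smul, eval_bracket_smul,
      ← hz a b, smul_sub, add_comm a b, ← (anchorBracket x y).evalAt a b c, hs]
    abel
  | del z hz =>
    intro a b
    simp only [eval_bracket_T, map_add, map_smul, ← hz a b, map_sub, add_smul, smul_sub]
    abel

/-- Only the third argument can be extended directly; rotations bring each argument there in turn.
-/
theorem jacobi [Infinite 𝔽] (x y z : CurrentModule 𝔽 R F) : Jacobi x y z :=
  .right (fun w => .rotate <| .right (fun v => .rotate <| .right (fun u => jacobi_of v w u) x) y) z

variable (𝔽 R F) in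
/-- The current Lie conformal algebroid of a Lie algebroid. -/
def algebroid [Infinite 𝔽] : LieConformalAlgebroid (deriv 𝔽 R) (CurrentModule 𝔽 R F) where
  bracket := bracket 𝔽 R F
  bracket_del_left := bracket_T_left
  bracket_del_right x := (isAdjoint_bracket x).del
  skew := bracket_skew
  jacobi x y z := ext_eval₂ fun a b => by
    have h12 : ∀ x : LPoly (LPoly (CurrentModule 𝔽 R F)),
        eval₂ a b ((var₁ 𝔽 + var₂ 𝔽 : Module.End 𝔽 _) x) = (a + b) • eval₂ a b x := fun x => by
      rw [LinearMap.add_apply, map_add, eval₂_var₁, eval₂_var₂, add_smul]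
    have h : ∀ {S : Module.End 𝔽 (LPoly (LPoly (CurrentModule 𝔽 R F)))} {c : 𝔽},
        (∀ x, eval₂ a b (S x) = c • eval₂ a b x) → ∀ p : LPoly (CurrentModule 𝔽 R F),
          eval₂ a b (subst S const₂ p) = eval c p :=
      fun hS => eval₂_subst hS const₂ LinearMap.id (eval₂_const₂ a b)
    rw [map_sub,
      eval₂_subst (eval₂_var₂ a b) _ (eval a ∘ₗ bracket 𝔽 R F x) fun e => h (eval₂_var₁ a b) _,
      eval₂_subst (eval₂_var₁ a b) _ (eval b ∘ₗ bracket 𝔽 R F y) fun e => h (eval₂_var₂ a b) _,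
      eval₂_subst (eval₂_var₁ a b)
        (fun e => subst (var₁ 𝔽 + var₂ 𝔽) const₂ (bracket 𝔽 R F e z))
        (eval (a + b) ∘ₗ (bracket 𝔽 R F).flip z) fun e => h h12 _]
    exact CurrentModule.jacobi x y z a b
  anchor := anchor 𝔽 R F
  leibniz x a y := (isAdjoint_bracket x).smul a y
  anchor_bracket x y b := ext_eval₂ fun a c => by
    have h21 : ∀ x : LPoly (LPoly (Jet 𝔽 R)),
        eval₂ a c ((var₂ 𝔽 - var₁ 𝔽 : Module.End 𝔽 _) x) = (c - a) • eval₂ a c x := fun x => by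
      rw [LinearMap.sub_apply, map_sub, eval₂_var₁, eval₂_var₂, sub_smul]
    have h : ∀ {S : Module.End 𝔽 (LPoly (LPoly (Jet 𝔽 R)))} {e : 𝔽},
        (∀ x, eval₂ a c (S x) = e • eval₂ a c x) → ∀ p : LPoly (Jet 𝔽 R),
          eval₂ a c (subst S const₂ p) = eval e p :=
      fun hS => eval₂_subst hS const₂ LinearMap.id (eval₂_const₂ a c)
    rw [map_sub,
      eval₂_subst (eval₂_var₁ a c) (fun e => subst (var₂ 𝔽) const₂ ((anchor 𝔽 R F e).1 b))
        (eval c ∘ₗ (anchorL 𝔽 R F).flip b) fun e => h (eval₂_var₂ a c) _,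
      eval₂_subst h21 (fun b => subst (var₁ 𝔽) const₂ ((anchor 𝔽 R F x).1 b))
        (evalAt a (anchor 𝔽 R F x)) fun e => h (eval₂_var₁ a c) _,
      eval₂_subst (eval₂_var₁ a c)
        (fun b => subst (var₂ 𝔽 - var₁ 𝔽) const₂ ((anchor 𝔽 R F y).1 b))
        (evalAt (c - a) (anchor 𝔽 R F y)) fun e => h h21 _]
    -- With `λ = a` and `μ = c`, the value of `μ - λ` is `c - a`, and the two scalars add up to `c`
    -- as the anchor of the bracket requires.
    have := (anchorBracket x y).evalAt a (c - a) b
    rw [sub_add_cancel] at this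
    exact this.symm

theorem isCurrent_algebroid [Infinite 𝔽] : IsCurrent (algebroid 𝔽 R F) := by
  refine ⟨bracket_of_of, fun u => ?_⟩
  change IsConformalLift _ (anchor 𝔽 R F (of 𝔽 R u))
  rw [anchor_of]
  exact isConformalLift _

/-- The anchors agree on generators, hence everywhere. The brackets are then adjoint operators with
equal anchors, which reduces the right argument to a generator; skew-symmetry moves it to the left,
and the same argument reduces the other one. -/
theorem isCurrent_unique {S S' : LieConformalAlgebroid (deriv 𝔽 R) (CurrentModule 𝔽 R F)}
    (h : IsCurrent S) (h' : IsCurrent S') : S = S' := by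
  have hθ : S.anchor = S'.anchor := by
    refine LinearMap.ext fun y => ?_
    induction y using CurrentModule.induction with
    | of u => exact conformalLift_unique (h.2 u) (h'.2 u)
    | add y z hy hz => rw [map_add, map_add, hy, hz]
    | smul a y hy => rw [← DiffOp.ofFun_smul (d := deriv 𝔽 R) a y, map_smul, map_smul, hy]
    | del y hy => rw [DiffOp.delEnd_apply, map_smul, map_smul, hy]
  have hS : ∀ (S : LieConformalAlgebroid (deriv 𝔽 R) (CurrentModule 𝔽 R F)) x,
      IsAdjoint (S.anchor x) (S.bracket x) := fun S x =>
    ⟨map_add _, S.bracket_del_right x, S.leibniz x⟩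
  refine LieConformalAlgebroid.ext (LinearMap.ext₂ fun x y => ?_) hθ
  have hx := hS S x
  rw [hθ] at hx
  refine hx.unique (hS S' x) (fun v => ?_) y
  rw [S.skew (of 𝔽 R v) x, S'.skew (of 𝔽 R v) x]
  have hv := hS S (of 𝔽 R v)
  rw [hθ] at hv
  rw [hv.unique (hS S' _) (fun w => ?_) x]
  rw [h.1, h'.1]

end CurrentModule

/-! ### The quotient of the jet algebra. -/

namespace Jet

variable (𝔽 R : Type*) [Field 𝔽] [CommRing R] [Algebra 𝔽 R]

/-- The retraction `J_∞ R → R` that kills all derivatives. -/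
def retract : Jet 𝔽 R →ₐ[𝔽] R := (existsUnique_lift 𝔽 R 0 (AlgHom.id 𝔽 R)).exists.choose

theorem retract_deriv (a : Jet 𝔽 R) : retract 𝔽 R (deriv 𝔽 R a) = 0 :=
  (existsUnique_lift 𝔽 R 0 (AlgHom.id 𝔽 R)).exists.choose_spec.1 a

theorem retract_ι (r : R) : retract 𝔽 R (ι 𝔽 R r) = r :=
  (existsUnique_lift 𝔽 R 0 (AlgHom.id 𝔽 R)).exists.choose_spec.2 r

theorem mk_ι_retract (a : Jet 𝔽 R) :
    (Ideal.Quotient.mk _ (ι 𝔽 R (retract 𝔽 R a)) : QuotAlg (deriv 𝔽 R)) =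
      Ideal.Quotient.mk _ a := by
  induction a using Jet.induction with
  | ι r => rw [retract_ι]
  | add a b ha hb => simp only [map_add, ha, hb]
  | mul a b ha hb => simp only [map_mul, ha, hb]
  | deriv a ha =>
    rw [retract_deriv, map_zero, map_zero]
    refine (Ideal.Quotient.eq_zero_iff_mem.2 ?_).symm
    exact Ideal.subset_span ⟨a, rfl⟩

/-- The isomorphism of `R` with the quotient of its jet algebra. -/
def quotEquiv : R ≃ₐ[𝔽] QuotAlg (deriv 𝔽 R) :=
  AlgEquiv.ofBijective
    ((Ideal.Quotient.mkₐ 𝔽 (Ideal.span (Set.range (deriv 𝔽 R)))).comp (ι 𝔽 R)) <| by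
    refine ⟨fun r s h => ?_, fun x => ?_⟩
    · have hle : Ideal.span (Set.range (deriv 𝔽 R)) ≤ RingHom.ker (retract 𝔽 R) := by
        refine Ideal.span_le.2 ?_
        rintro _ ⟨a, rfl⟩
        exact retract_deriv 𝔽 R a
      have h : ι 𝔽 R r - ι 𝔽 R s ∈ RingHom.ker (retract 𝔽 R) := hle (Ideal.Quotient.eq.1 h)
      rwa [RingHom.mem_ker, map_sub, retract_ι, retract_ι, sub_eq_zero] at h
    · obtain ⟨a, rfl⟩ := Ideal.Quotient.mk_surjective x
      exact ⟨retract 𝔽 R a, mk_ι_retract 𝔽 R a⟩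

theorem quotEquiv_apply (r : R) : quotEquiv 𝔽 R r = Ideal.Quotient.mk _ (ι 𝔽 R r) := rfl

/-- The homomorphism `J_∞ R[∂] → R` that kills all derivatives. -/
def diffOpRetract : DiffOp (deriv 𝔽 R) →+* R :=
  DiffOp.lift (retract 𝔽 R : Jet 𝔽 R →+* R) 0 fun a => by
    rw [zero_mul, mul_zero, zero_add]; exact (retract_deriv 𝔽 R a).symm

theorem diffOpRetract_ofFun (a : Jet 𝔽 R) :
    diffOpRetract 𝔽 R (DiffOp.ofFun a) = retract 𝔽 R a :=
  (DiffOp.act_mono (d := deriv 𝔽 R) _ _ 0 a).trans (by rw [pow_zero, mul_one]; rfl)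

theorem diffOpRetract_del : diffOpRetract 𝔽 R (DiffOp.del _) = 0 :=
  (DiffOp.act_mono (d := deriv 𝔽 R) _ _ 1 1).trans (by rw [pow_one, mul_zero])

end Jet

/-! ### The quotient of the current algebroid. -/

namespace CurrentModule

open LPoly Jet

variable {𝔽 R : Type*} [Field 𝔽] [CommRing R] [Algebra 𝔽 R]

/-- Here `F` is a module over `J_∞ R[∂]` through `diffOpRetract`, so the identity of `F` extends
from the generators. -/
theorem exists_retract (F : Type*) [AddCommGroup F] [Module R F] :
    ∃ G : CurrentModule 𝔽 R F →+ F, (∀ (a : Jet 𝔽 R) y, G (a • y) = retract 𝔽 R a • G y) ∧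
      (∀ y, G (T 𝔽 R F y) = 0) ∧ ∀ v, G (of 𝔽 R v) = v := by
  obtain ⟨G, hG, hof⟩ := exists_addHom ((Module.toAddMonoidEnd R F).comp (diffOpRetract 𝔽 R))
    (id : F → F) (fun _ _ => rfl) fun r v => by
      change r • v = diffOpRetract 𝔽 R _ • v
      rw [diffOpRetract_ofFun, retract_ι]
  refine ⟨G, fun a y => ?_, fun y => ?_, hof⟩
  · rw [← DiffOp.ofFun_smul (d := deriv 𝔽 R) a y, hG]
    change diffOpRetract 𝔽 R _ • G y = _
    rw [diffOpRetract_ofFun]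
  · rw [DiffOp.delEnd_apply, hG]
    change diffOpRetract 𝔽 R _ • G y = _
    rw [diffOpRetract_del, zero_smul]

variable {F : Type*} [LieRing F] [LieAlgebra 𝔽 F] [Module R F] [LieRingModule F R]
  [LieRinehartRing R F] [LieRinehartAlgebra 𝔽 R F]

/-- The retraction `G` kills `A∂E` and is the identity on generators, which gives injectivity.
Modulo `A∂E` every `y` equals `1 ⊗ G(y)`, which gives surjectivity. Only the module matters, so `S`
is arbitrary. -/
theorem bijective_mk_of (S : LieConformalAlgebroid (deriv 𝔽 R) (CurrentModule 𝔽 R F)) :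
    Function.Bijective fun u : F => QuotMod.mk S (of 𝔽 R u) := by
  obtain ⟨G, hsmul, hdel, hof⟩ := exists_retract (𝔽 := 𝔽) (R := R) F
  have hG : ∀ y ∈ delSpan (deriv 𝔽 R) (CurrentModule 𝔽 R F), G y = 0 := by
    intro y hy
    refine Submodule.span_induction ?_ ?_ ?_ ?_ hy
    · rintro _ ⟨e, rfl⟩; exact hdel e
    · exact map_zero G
    · intro x y _ _ hx hy; rw [map_add, hx, hy, add_zero]
    · intro a x _ hx; rw [hsmul, hx, smul_zero]
  have hmk : ∀ y, QuotMod.mk S (of 𝔽 R (G y)) = QuotMod.mk S y := by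
    intro y
    induction y using CurrentModule.induction with
    | of v => rw [hof]
    | add y z hy hz => rw [map_add, of_add, map_add, map_add, hy, hz]
    | smul a y hy =>
      rw [hsmul, of_smul, ← QuotMod.mk_smul_mk, mk_ι_retract, QuotMod.mk_smul_mk, map_smul, hy,
        map_smul]
    | del y hy =>
      rw [hdel]
      refine QuotMod.mk_eq S ?_
      rw [of, TensorProduct.tmul_zero, zero_sub]
      exact Submodule.neg_mem _ (LieConformalAlgebroid.del_mem y)
  refine ⟨fun u v h => ?_, fun x => ?_⟩
  · have h := hG _ (QuotMod.mk_sub_mem S h)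
    rwa [map_sub, hof, hof, sub_eq_zero] at h
  · obtain ⟨y, rfl⟩ := QuotMod.mk_surjective S x
    exact ⟨G y, hmk y⟩

/-- The canonical isomorphism of a Lie algebroid with the quotient of its current Lie conformal
algebroid. -/
def quotHom [CharZero 𝔽] (S : LieConformalAlgebroid (deriv 𝔽 R) (CurrentModule 𝔽 R F))
    (hS : IsCurrent S) :
    LieRinehartAlgebra.Hom (quotEquiv 𝔽 R : R →ₐ[𝔽] QuotAlg (deriv 𝔽 R)) F (QuotMod S) where
  toFun u := QuotMod.mk S (of 𝔽 R u)
  map_add' u v := by rw [of_add, map_add]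
  map_smul' c u := by
    rw [← algebraMap_smul R c u, of_smul, AlgHom.commutes, algebraMap_smul]; rfl
  map_lie' {u v} := by
    rw [QuotMod.bracket_mk, hS.1, const, Finsupp.single_eq_same]
  map_smul_apply' r u := by
    change QuotMod.mk S (of 𝔽 R (r • u)) = quotEquiv 𝔽 R r • QuotMod.mk S (of 𝔽 R u)
    rw [of_smul, quotEquiv_apply, QuotMod.mk_smul_mk]
  apply_lie' r u := by
    change quotEquiv 𝔽 R ⁅u, r⁆ = ⁅QuotMod.mk S (of 𝔽 R u), quotEquiv 𝔽 R r⁆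
    rw [quotEquiv_apply, quotEquiv_apply, QuotMod.bracket_mk_alg, hS.2, const,
      Finsupp.single_eq_same]
    rfl

end CurrentModule

end

theorem mainTheorem8 {𝔽 R F : Type*} [Field 𝔽] [CharZero 𝔽] [CommRing R] [Algebra 𝔽 R]
    [Algebra.FiniteType 𝔽 R] [LieRing F] [LieAlgebra 𝔽 F] [Module R F] [LieRingModule F R]
    [LieRinehartRing R F] [LieRinehartAlgebra 𝔽 R F] :
    (∀ D : Derivation 𝔽 R R, ∃! φ : CDer (Jet.deriv 𝔽 R), Jet.IsConformalLift D φ) ∧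
    ∃ S : LieConformalAlgebroid (Jet.deriv 𝔽 R) (CurrentModule 𝔽 R F),
      IsCurrent S ∧ (∀ S₁ : LieConformalAlgebroid (Jet.deriv 𝔽 R) (CurrentModule 𝔽 R F),
        IsCurrent S₁ → S₁ = S) ∧
      ∃ (σ : R ≃ₐ[𝔽] QuotAlg (Jet.deriv 𝔽 R))
        (e : LieRinehartAlgebra.Hom (σ : R →ₐ[𝔽] QuotAlg (Jet.deriv 𝔽 R)) F (QuotMod S)),
        Function.Bijective e ∧ (∀ r, σ r = Ideal.Quotient.mk _ (Jet.ι 𝔽 R r)) ∧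
          ∀ u, e u = QuotMod.mk S (1 ⊗ₜ u) := by
  refine ⟨fun D => ⟨Jet.conformalLift D, Jet.isConformalLift D, fun φ hφ =>
    Jet.conformalLift_unique hφ (Jet.isConformalLift D)⟩, ?_⟩
  -- Characteristic zero supplies enough scalars for the evaluation arguments.
  have : Infinite 𝔽 := Infinite.of_injective _ (Nat.cast_injective (R := 𝔽))
  have hS := CurrentModule.isCurrent_algebroid (𝔽 := 𝔽) (R := R) (F := F)
  exact ⟨CurrentModule.algebroid 𝔽 R F, hS, fun S₁ h => CurrentModule.isCurrent_unique h hS,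
    Jet.quotEquiv 𝔽 R, CurrentModule.quotHom _ hS, CurrentModule.bijective_mk_of _,
    Jet.quotEquiv_apply 𝔽 R, fun _ => rfl⟩
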